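/- For a finite set $V\subset\mathbb R$ let $G_1(V)$ be the graph on $V$ in which distinct $u,v$ are adjacent iff $|u-v|\le 1$, and let $N_{k,1}(V)$ be the maximum number of vertices of $G_1(V)$ that can be properly coloured with $k$ colours. Let $k\ge 0$ be an integer. (a) Inspect the points of a finite set $V\subset\mathbb R$ from left to right; select a point $x$ if fewer than $k$ points of $[x-1,x]$ have been selected so far, giving it any colour not already used on $[x-1,x]$, and skip it otherwise. This procedure can be carried out, and each of its possible results is a proper $k$-colouring of the selected points in $G_1(V)$ with exactly $N_{k,1}(V)$ coloured points. The selected points are exactly the arrival times of the customers admitted in the Erlang loss system with arrival times $V$, unit service times (a customer admitted at time $y$ is present during $[y,y+1]$), capacity $k$, and empty initial state. (b) Let $\lambda>0$, let $\mathcal X_\lambda$ be a Poisson point process of intensity $\lambda$ on $\mathbb R$, let $F_{k,\lambda}(t)=N_{k,1}([0,t]\cap\mathcal X_\lambda)$, and let $a_{k,\lambda}=\inf_{t>0}\mathbb E[F_{k,\lambda}(t)]/(\lambda t)$. Let $A(k,\lambda,t)$ be the number of customers admitted during $[0,t]$ in the Erlang loss system with unit service times and capacity $k$, empty at time $0$,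 with the points of $\mathcal X_\lambda\cap[0,t]$ as arrival times. Then $F_{k,\lambda}(t)=A(k,\lambda,t)$ for all $t$, $F_{k,\lambda}(t)$ is integrable, $A(k,\lambda,t)/(\lambda t)\to 1-\mathrm{Erl}(\lambda,k)$ in probability as $t\to\infty$, where $$\mathrm{Erl}(\lambda,k)=\frac{\lambda^k/k!}{\sum_{l=0}^{k}\lambda^l/l!},$$ $\mathbb E[F_{k,\lambda}(t)]/(\lambda t)\to a_{k,\lambda}$ as $t\to\infty$, and $$a_{k,\lambda}=1-\mathrm{Erl}(\lambda,k)=\frac{\sum_{m=0}^{k-1}\lambda^m/m!}{\sum_{l=0}^{k}\lambda^l/l!}.$$ -/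

import Mathlib

open MeasureTheory ProbabilityTheory Filter Topology

noncomputable section

namespace RGGColouring

/-! ### Random geometric graphs and maximum `k`-colourings -/

/-- The geometric graph `G_r(V)`: its vertex set is `V`, and two distinct points of `V` are joined
when their distance is at most `r`. -/
def geomGraph {E : Type*} [MetricSpace E] (r : ℝ) (V : Set E) : SimpleGraph V where
  Adj u v := u ≠ v ∧ dist (u : E) (v : E) ≤ r
  symm := ⟨fun u v h => ⟨h.1.symm, by rw [dist_comm]; exact h.2⟩⟩
  loopless := ⟨fun _ h => h.1 rfl⟩

/-- The maximum number of vertices of a graph on finitely many vertices that can be properly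
coloured with `k` colours: the largest size of a set `S` of vertices whose induced subgraph is
properly `k`-colourable. -/
def maxColoured {W : Type*} (G : SimpleGraph W) (k : ℕ) : ℕ :=
  sSup {n : ℕ | ∃ S : Finset W, (G.induce (S : Set W)).Colorable k ∧ S.card = n}

/-- `N_{k,r}(V)`, the maximum number of vertices of `G_r(V)` that can be properly coloured with `k`
colours (for a finite set `V`). -/
def colourNumber {E : Type*} [MetricSpace E] (k : ℕ) (r : ℝ) (V : Set E) : ℕ :=
  maxColoured (geomGraph r V) k

/-! ### The greedy procedure on the line

A partial colouring is a map `c : ℝ → Option (Fin k)`; `c x = none` means that `x` is not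
coloured. -/

/-- `GreedyRun k V c`: the partial colouring `c` is a possible result of inspecting the points of
the finite set `V ⊂ ℝ` one by one from left to right, where an inspected point `x` is selected if
fewer than `k` points of `[x - 1, x]` have been selected before, in which case it receives an
arbitrary colour not already used on `[x - 1, x]`, and is skipped otherwise. -/
inductive GreedyRun (k : ℕ) : Finset ℝ → (ℝ → Option (Fin k)) → Prop
  | start : GreedyRun k ∅ (fun _ => none)
  | select (V : Finset ℝ) (c : ℝ → Option (Fin k)) (x : ℝ) (i : Fin k)
      (run : GreedyRun k V c) (left : ∀ v ∈ V, v < x)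
      (room : (V.filter fun y => y ∈ Set.Icc (x - 1) x ∧ c y ≠ none).card < k)
      (free : ∀ y ∈ V, y ∈ Set.Icc (x - 1) x → c y ≠ some i) :
      GreedyRun k (insert x V) (Function.update c x (some i))
  | skip (V : Finset ℝ) (c : ℝ → Option (Fin k)) (x : ℝ)
      (run : GreedyRun k V c) (left : ∀ v ∈ V, v < x)
      (full : k ≤ (V.filter fun y => y ∈ Set.Icc (x - 1) x ∧ c y ≠ none).card) :
      GreedyRun k (insert x V) c

/-- The set of points of `V` that are coloured by `c`. -/
def colouredPart {k : ℕ} (V : Finset ℝ) (c : ℝ → Option (Fin k)) : Finset ℝ :=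
  V.filter fun x => c x ≠ none

/-- The partial colouring `c` is proper on `G_r(V)`: adjacent coloured points of `V` have
different colours. -/
def IsProperOn {k : ℕ} (r : ℝ) (V : Finset ℝ) (c : ℝ → Option (Fin k)) : Prop :=
  ∀ u v : (V : Set ℝ), (geomGraph r (V : Set ℝ)).Adj u v → c u ≠ none → c u ≠ c v

/-! ### The Erlang loss system -/

/-- State of a loss system: the departure epochs of the customers in service, and the arrival
epochs of all customers admitted so far. -/
structure LossState where
  inService : Multiset ℝ
  admitted : Finset ℝ

/-- Arrival of a customer at time `x` in a loss system with capacity `k` and deterministic service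
times `σ`. A customer admitted at time `y` is in service during `[y, y + σ]`; so first all
customers with a departure epoch before `x` are removed, and then the arriving customer is admitted
if fewer than `k` customers are present, and is lost otherwise. -/
def lossStep (k : ℕ) (σ : ℝ) (s : LossState) (x : ℝ) : LossState :=
  let present := s.inService.filter fun e => x ≤ e
  if present.card < k then ⟨(x + σ) ::ₘ present, insert x s.admitted⟩
  else ⟨present, s.admitted⟩

/-- The arrival epochs of the customers that are admitted in a loss system with capacity `k` and
service times `σ`, starting empty, when `V` is the set of all arrival epochs. -/
def erlangAdmitted (k : ℕ) (σ : ℝ) (V : Finset ℝ) : Finset ℝ :=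
  ((V.sort (· ≤ ·)).foldl (lossStep k σ) ⟨0, ∅⟩).admitted

/-- The Erlang loss probability `(ρ^k / k!) / ∑_{l ≤ k} ρ^l / l!`. -/
def erlangLoss (ρ : ℝ) (k : ℕ) : ℝ :=
  (ρ ^ k / (k.factorial : ℝ)) / ∑ l ∈ Finset.range (k + 1), ρ ^ l / (l.factorial : ℝ)

/-! ### Poisson point processes on the line and the constant `a_{k,λ}` -/

/-- `X` is a (homogeneous) Poisson point process of intensity `lam` on `ℝ`: a random locally finite
set of points such that the numbers of points in bounded Borel sets are random variables, the
number of points in `B` is Poisson distributed with mean `lam * |B|`, and the numbers of points in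
pairwise disjoint sets are independent. -/
structure IsPoissonProcess {Ω : Type*} [MeasurableSpace Ω] (P : Measure Ω) (lam : ℝ)
    (X : Ω → Set ℝ) : Prop where
  locallyFinite : ∀ (ω : Ω) (B : Set ℝ), Bornology.IsBounded B → (X ω ∩ B).Finite
  measurable_count : ∀ B : Set ℝ, MeasurableSet B → Bornology.IsBounded B →
    Measurable fun ω => (X ω ∩ B).ncard
  count_law : ∀ B : Set ℝ, MeasurableSet B → Bornology.IsBounded B →
    HasLaw (fun ω => (X ω ∩ B).ncard) (poissonMeasure (Real.toNNReal (lam * volume.real B))) P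
  indep : ∀ (n : ℕ) (B : Fin n → Set ℝ),
    (∀ i, MeasurableSet (B i) ∧ Bornology.IsBounded (B i)) →
    Pairwise (fun i j => Disjoint (B i) (B j)) →
    iIndepFun (fun (i : Fin n) ω => (X ω ∩ B i).ncard) P

variable {Ω : Type*}

/-- `F_{k,λ}(t) = N_{k,1}([0, t] ∩ X)` in dimension one. -/
def colouredCount (k : ℕ) (X : Ω → Set ℝ) (t : ℝ) (ω : Ω) : ℕ :=
  colourNumber k 1 (Set.Icc 0 t ∩ X ω)

open Classical in
/-- The points of `X` in `[0, t]`, as a finite set (`∅` if there are infinitely many, which does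
not happen for a locally finite set). -/
def arrivals (X : Ω → Set ℝ) (t : ℝ) (ω : Ω) : Finset ℝ :=
  if h : (Set.Icc 0 t ∩ X ω).Finite then h.toFinset else ∅

/-- `A(k, λ, t)`: the number of customers admitted during `[0, t]` in the Erlang loss system with
unit service times and capacity `k`, empty at time `0`, with the points of `X` as arrival epochs. -/
def admittedCount (k : ℕ) (X : Ω → Set ℝ) (t : ℝ) (ω : Ω) : ℕ :=
  (erlangAdmitted k 1 (arrivals X t ω)).card

/-- The mean colouring ratio `E[F_{k,λ}(t)] / (λ t)`. -/
def meanColouringRatio [MeasurableSpace Ω] (P : Measure Ω) (lam : ℝ) (X : Ω → Set ℝ) (k : ℕ)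
    (t : ℝ) : ℝ :=
  ∫ ω, (colouredCount k X t ω : ℝ) / (lam * t) ∂P

/-- The constant `a_{k,λ}`, the infimum over `t > 0` of the mean colouring ratio. -/
def colouringConstant [MeasurableSpace Ω] (P : Measure Ω) (lam : ℝ) (X : Ω → Set ℝ) (k : ℕ) : ℝ :=
  ⨅ t : Set.Ioi (0 : ℝ), meanColouringRatio P lam X k t

end RGGColouring

end

/-! Deterministic half. The colouring procedure and the loss system both produce a set `A ⊆ V` to
which a point `x` of `V` belongs iff fewer than `k` points of `A` lie in `[x - 1, x)`. Such a set is
unique (`IsGreedySelection.unique`), so the two coincide. Points in a window of length 1 form a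
clique, so a `k`-colourable set has at most `k` points per window, and among all such sets the
greedy one is largest (`IsGreedySelection.card_le`).

Probabilistic half. Cut `[0, t)` into `n` slots of length `t / n` and record only whether each slot
contains a point. The bits are independent with success probability `p = 1 - exp (-λt/n)`, and
almost surely the slotted loss system admits, for all large `n`, exactly as many customers as the
original one. The slotted system has an explicit stationary law: a history of `w + 1` slots with at
most `k` admissions has weight `r ^ (number of admissions)`, where `r = p / (1 - p)`
(`bitSum_histWeight_slotStep`). This gives an exact admission rate `ρ` per slot. A coupling
(`slotAdmissions_coupling`) shows that the empty start admits at least as many customers as any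
other start, and at most `k` more than a start with at most `k` admissions in its window. Hence the
mean from the empty start lies in `[nρ, nρ + k]`, and a one-slot recursion bounds the second moment
about `nρ` by `np(4k + 2)` (`secondMoment_le`).

As `n → ∞` the binomial sums in `nρ` become the Erlang sums, so with `a = 1 - Erl(λ, k)` one gets
`λta ≤ E F(t) ≤ λta + k` and `E (F(t) - λta)² ≤ λt(4k + 2)`. Division by `λt` yields the infimum and
the limit of the means; Chebyshev's inequality yields convergence in probability. -/

namespace RGGColouring

/-! ### Greedy selections on the line: uniqueness and optimality -/

/-- `A` is the set of points of `V` selected by the greedy rule: a point `x` is selected iff fewer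
than `k` points of `[x - r, x)` are selected. -/
def IsGreedySelection (k : ℕ) (r : ℝ) (V A : Finset ℝ) : Prop :=
  A ⊆ V ∧ ∀ x ∈ V, (x ∈ A ↔ (A.filter fun y => x - r ≤ y ∧ y < x).card < k)

/-- At the leftmost point of disagreement both sets agree strictly to the left, hence on the window
that decides membership. -/
theorem IsGreedySelection.unique {k : ℕ} {r : ℝ} {V A B : Finset ℝ}
    (hA : IsGreedySelection k r V A) (hB : IsGreedySelection k r V B) : A = B := by
  by_contra hne
  have hD : (V.filter fun x => ¬ (x ∈ A ↔ x ∈ B)).Nonempty := by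
    by_contra hD
    rw [Finset.not_nonempty_iff_eq_empty, Finset.filter_eq_empty_iff] at hD
    apply hne
    ext x
    by_cases hx : x ∈ V
    · simpa using hD hx
    · exact ⟨fun h => absurd (hA.1 h) hx, fun h => absurd (hB.1 h) hx⟩
  obtain ⟨x, hx, hmin⟩ := Finset.exists_minimal hD
  rw [Finset.mem_filter] at hx
  apply hx.2
  rw [hA.2 x hx.1, hB.2 x hx.1]
  have : (A.filter fun y => x - r ≤ y ∧ y < x) = (B.filter fun y => x - r ≤ y ∧ y < x) := by
    ext y
    simp only [Finset.mem_filter]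
    refine and_congr_left fun hy => ?_
    by_cases hyV : y ∈ V
    · by_contra hcon
      exact absurd (hmin (Finset.mem_filter.2 ⟨hyV, hcon⟩) hy.2.le) (not_le.2 hy.2)
    · exact ⟨fun h => absurd (hA.1 h) hyV, fun h => absurd (hB.1 h) hyV⟩
  rw [this]

theorem isGreedySelection_empty (k : ℕ) (r : ℝ) : IsGreedySelection k r ∅ ∅ :=
  ⟨subset_rfl, by simp⟩

theorem IsGreedySelection.insert_of_lt {k : ℕ} {r : ℝ} {V A : Finset ℝ} {x : ℝ}
    (hA : IsGreedySelection k r V A) (hx : ∀ v ∈ V, v < x)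
    (h : (A.filter fun y => x - r ≤ y).card < k) :
    IsGreedySelection k r (insert x V) (insert x A) := by
  refine ⟨Finset.insert_subset_insert _ hA.1, fun z hz => ?_⟩
  have key : ∀ z ≤ x, ((insert x A).filter fun y => z - r ≤ y ∧ y < z)
      = A.filter fun y => z - r ≤ y ∧ y < z := fun z hz => by
    rw [Finset.filter_insert, if_neg (fun h => absurd h.2 (not_lt.2 hz))]
  rcases Finset.mem_insert.1 hz with rfl | hzV
  · rw [key _ le_rfl]
    refine iff_of_true (Finset.mem_insert_self _ _) (lt_of_le_of_lt (Finset.card_le_card ?_) h)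
    exact Finset.monotone_filter_right _ fun y _ hy => hy.1
  · rw [key _ (hx z hzV).le, ← hA.2 z hzV, Finset.mem_insert, or_iff_right (hx z hzV).ne]

theorem IsGreedySelection.insert_of_le {k : ℕ} {r : ℝ} {V A : Finset ℝ} {x : ℝ}
    (hA : IsGreedySelection k r V A) (hx : ∀ v ∈ V, v < x)
    (h : k ≤ (A.filter fun y => x - r ≤ y).card) :
    IsGreedySelection k r (insert x V) A := by
  refine ⟨hA.1.trans (Finset.subset_insert _ _), fun z hz => ?_⟩
  rcases Finset.mem_insert.1 hz with rfl | hzV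
  · refine iff_of_false (fun hz => (hx z (hA.1 hz)).false) (not_lt.2 (h.trans_eq ?_))
    congr 1
    exact Finset.filter_congr fun y hy => by simp [hx y (hA.1 hy)]
  · exact hA.2 z hzV

/-- The greedy selection is at least as large as any set with at most `k` points in each window. -/
theorem IsGreedySelection.card_le {k : ℕ} {r : ℝ} (hr : 0 ≤ r) {V A S : Finset ℝ}
    (hA : IsGreedySelection k r V A) (hSV : S ⊆ V)
    (hS : ∀ x ∈ S, (S.filter fun y => x - r ≤ y ∧ y ≤ x).card ≤ k) : S.card ≤ A.card := by
  have key : ∀ n : ℕ, ∀ x : ℝ, (V.filter fun y => y < x).card ≤ n →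
      (S.filter fun y => y < x).card ≤ (A.filter fun y => y < x).card := by
    intro n
    induction n with
    | zero =>
      intro x hx
      have : (S.filter fun y => y < x).card ≤ (V.filter fun y => y < x).card :=
        Finset.card_le_card (Finset.filter_subset_filter _ hSV)
      omega
    | succ n ih =>
      intro x hx
      by_cases hne : (V.filter fun y => y < x).Nonempty
      · obtain ⟨z, hz, hmax⟩ := Finset.exists_maximal hne
        rw [Finset.mem_filter] at hz
        have hmax' : ∀ y ∈ V, y < x → y ≤ z := fun y hy hyx => by
          by_contra hcon
          exact hcon (hmax (Finset.mem_filter.2 ⟨hy, hyx⟩) (le_of_not_ge hcon))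
        have hzcard : (V.filter fun y => y < z).card ≤ n := by
          have : (V.filter fun y => y < z).card < (V.filter fun y => y < x).card := by
            apply Finset.card_lt_card
            rw [Finset.ssubset_iff_of_subset (Finset.monotone_filter_right _
              fun y _ hy => hy.trans hz.2)]
            exact ⟨z, Finset.mem_filter.2 hz, by simp⟩
          omega
        have hle : ∀ B : Finset ℝ, B ⊆ V →
            (B.filter fun y => y < x) = B.filter fun y => y ≤ z := fun B hB =>
          Finset.filter_congr fun y hy => ⟨fun h => hmax' y (hB hy) h, fun h => h.trans_lt hz.2⟩
        rw [hle S hSV, hle A hA.1]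
        have hsplit : ∀ B : Finset ℝ, z ∈ B → (B.filter fun y => y ≤ z).card
            = (B.filter fun y => y < z).card + 1 := fun B hB => by
          have : (B.filter fun y => y ≤ z) = insert z (B.filter fun y => y < z) := by
            ext y
            simp only [Finset.mem_filter, Finset.mem_insert, le_iff_lt_or_eq]
            constructor
            · rintro ⟨h, h1 | h1⟩
              · exact Or.inr ⟨h, h1⟩
              · exact Or.inl h1
            · rintro (rfl | ⟨h, h1⟩)
              · exact ⟨hB, Or.inr rfl⟩
              · exact ⟨h, Or.inl h1⟩
          rw [this, Finset.card_insert_of_notMem (by simp)]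
        have hmono : (A.filter fun y => y < z).card ≤ (A.filter fun y => y ≤ z).card :=
          Finset.card_le_card (Finset.monotone_filter_right _ fun y _ hy => le_of_lt hy)
        by_cases hzS : z ∈ S
        · by_cases hzA : z ∈ A
          · rw [hsplit S hzS, hsplit A hzA]
            exact Nat.succ_le_succ (ih z hzcard)
          · have hwin : k ≤ (A.filter fun y => z - r ≤ y ∧ y < z).card :=
              not_lt.1 (mt (hA.2 z hz.1).2 hzA)
            -- Here `S` takes `z` and `A` does not. `A` then has at least `k` points in `[z - r,
            -- z)`, while `S` has at most `k` in `[z - r, z]`, so it suffices to compare the two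
            -- sets left of `z - r`.
            have h1 := ih (z - r) (le_trans (Finset.card_le_card
              (Finset.monotone_filter_right _ fun y _ hy => by
                have : y < z - r := hy
                show y < z
                linarith)) hzcard)
            have h2 : (S.filter fun y => y ≤ z).card ≤
                (S.filter fun y => y < z - r).card
                  + (S.filter fun y => z - r ≤ y ∧ y ≤ z).card := by
              refine (Finset.card_le_card ?_).trans (Finset.card_union_le _ _)
              intro y hy
              rw [Finset.mem_filter] at hy
              rw [Finset.mem_union, Finset.mem_filter, Finset.mem_filter]
              rcases lt_or_ge y (z - r) with h | h
              · exact Or.inl ⟨hy.1, h⟩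
              · exact Or.inr ⟨hy.1, h, hy.2⟩
            have h3 : (A.filter fun y => y < z - r).card
                + (A.filter fun y => z - r ≤ y ∧ y < z).card
                ≤ (A.filter fun y => y ≤ z).card := by
              rw [← Finset.card_union_of_disjoint]
              · refine Finset.card_le_card (Finset.union_subset ?_ ?_)
                · exact Finset.monotone_filter_right _ fun y _ hy => by
                    have : y < z - r := hy
                    show y ≤ z
                    linarith
                · exact Finset.monotone_filter_right _ fun y _ hy => hy.2.le
              · rw [Finset.disjoint_filter]
                intro y _ h h'
                exact absurd h'.1 (not_le.2 h)
            have h4 := hS z hzS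
            omega
        · have : (S.filter fun y => y ≤ z) = S.filter fun y => y < z :=
            Finset.filter_congr fun y hy => ⟨fun h => lt_of_le_of_ne h fun h => hzS (h ▸ hy),
              fun h => h.le⟩
          rw [this]
          exact (ih z hzcard).trans hmono
      · have : (S.filter fun y => y < x).card ≤ (V.filter fun y => y < x).card :=
          Finset.card_le_card (Finset.filter_subset_filter _ hSV)
        rw [Finset.not_nonempty_iff_eq_empty] at hne
        rw [hne, Finset.card_empty] at this
        omega
  obtain ⟨x, hx⟩ : ∃ x : ℝ, ∀ v ∈ V, v < x := by
    obtain ⟨M, hM⟩ := V.bddAbove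
    exact ⟨M + 1, fun v hv => (hM hv).trans_lt (lt_add_one M)⟩
  have := key _ x le_rfl
  rwa [Finset.filter_true_of_mem fun y hy => hx y (hSV hy),
    Finset.filter_true_of_mem fun y hy => hx y (hA.1 hy)] at this

/-! ### Greedy runs as maximum colourings -/

theorem GreedyRun.eq_none {k : ℕ} {V : Finset ℝ} {c : ℝ → Option (Fin k)}
    (h : GreedyRun k V c) : ∀ x, x ∉ V → c x = none := by
  induction h with
  | start => simp
  | select V c x i _ _ _ _ ih =>
    intro y hy
    rw [Finset.mem_insert, not_or] at hy
    rw [Function.update_of_ne hy.1, ih y hy.2]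
  | skip V c x _ _ _ ih =>
    intro y hy
    exact ih y fun h => hy (Finset.mem_insert_of_mem h)

theorem colouredPart_insert_update {k : ℕ} {V : Finset ℝ} {c : ℝ → Option (Fin k)} {x : ℝ}
    {i : Fin k} (hx : ∀ v ∈ V, v < x) :
    colouredPart (insert x V) (Function.update c x (some i)) = insert x (colouredPart V c) := by
  unfold colouredPart
  rw [Finset.filter_insert, if_pos (by simp)]
  congr 1
  exact Finset.filter_congr fun y hy => by rw [Function.update_of_ne (hx y hy).ne]

theorem window_colouredPart {k : ℕ} {V : Finset ℝ} (c : ℝ → Option (Fin k)) {x : ℝ}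
    (hx : ∀ v ∈ V, v < x) : (V.filter fun y => y ∈ Set.Icc (x - 1) x ∧ c y ≠ none)
      = (colouredPart V c).filter fun y => x - 1 ≤ y := by
  unfold colouredPart
  rw [Finset.filter_filter]
  exact Finset.filter_congr fun y hy => by
    rw [Set.mem_Icc, and_iff_left (hx y hy).le, and_comm]

theorem GreedyRun.isGreedySelection {k : ℕ} {V : Finset ℝ} {c : ℝ → Option (Fin k)}
    (h : GreedyRun k V c) : IsGreedySelection k 1 V (colouredPart V c) := by
  induction h with
  | start => exact isGreedySelection_empty k 1
  | select V c x i run left room _ ih =>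
    rw [colouredPart_insert_update left]
    rw [window_colouredPart c left] at room
    exact ih.insert_of_lt left room
  | skip V c x run left full ih =>
    have : colouredPart (insert x V) c = colouredPart V c := by
      unfold colouredPart
      rw [Finset.filter_insert, if_neg]
      rw [not_not]
      exact run.eq_none x fun h => (left x h).false
    rw [this]
    rw [window_colouredPart c left] at full
    exact ih.insert_of_le left full

theorem GreedyRun.ne_of_abs_sub_le {k : ℕ} {V : Finset ℝ} {c : ℝ → Option (Fin k)}
    (h : GreedyRun k V c) :
    ∀ u ∈ V, ∀ v ∈ V, u < v → v - u ≤ 1 → c u ≠ none → c u ≠ c v := by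
  induction h with
  | start => simp
  | select V c x i run left room free ih =>
    intro u hu v hv huv hd hcu
    rcases Finset.mem_insert.1 hu with rfl | hu'
    · rcases Finset.mem_insert.1 hv with rfl | hv'
      · exact absurd huv (lt_irrefl _)
      · exact absurd huv (not_lt.2 (left v hv').le)
    · rw [Function.update_of_ne (left u hu').ne] at hcu ⊢
      rcases Finset.mem_insert.1 hv with rfl | hv'
      · rw [Function.update_self]
        exact free u hu' ⟨by linarith, huv.le⟩
      · rw [Function.update_of_ne (left v hv').ne]
        exact ih u hu' v hv' huv hd hcu
  | skip V c x run left full ih =>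
    intro u hu v hv huv hd hcu
    have hu' : u ∈ V := by
      by_contra hn
      exact hcu (run.eq_none u hn)
    by_cases hv' : v ∈ V
    · exact ih u hu' v hv' huv hd hcu
    · rw [run.eq_none v hv']
      exact hcu

theorem GreedyRun.isProperOn {k : ℕ} {V : Finset ℝ} {c : ℝ → Option (Fin k)}
    (h : GreedyRun k V c) : IsProperOn 1 V c := by
  rintro ⟨u, hu⟩ ⟨v, hv⟩ ⟨hne, hd⟩ hcu
  have hne' : u ≠ v := fun h => hne (Subtype.ext h)
  simp only [Real.dist_eq] at hd hcu ⊢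
  rcases lt_or_gt_of_ne hne' with huv | huv
  · exact h.ne_of_abs_sub_le u hu v hv huv
      (by rw [abs_sub_comm] at hd; exact (le_abs_self _).trans hd) hcu
  · intro heq
    exact h.ne_of_abs_sub_le v hv u hu huv ((le_abs_self _).trans hd) (heq ▸ hcu) heq.symm

theorem exists_greedyRun (k : ℕ) (V : Finset ℝ) : ∃ c, GreedyRun k V c := by
  induction V using Finset.induction_on_max with
  | empty => exact ⟨_, GreedyRun.start⟩
  | insert x V left ih =>
    obtain ⟨c, run⟩ := ih
    set W := V.filter fun y => y ∈ Set.Icc (x - 1) x ∧ c y ≠ none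
    by_cases room : W.card < k
    -- Pigeonhole: fewer than `k` coloured points in the window cannot use up all `k` colours.
    · have : ∃ i : Fin k, (some i : Option (Fin k)) ∉ W.image c := by
        by_contra! hcon
        have h1 : (Finset.univ.image (some : Fin k → Option (Fin k))) ⊆ W.image c := by
          intro o ho
          obtain ⟨i, -, rfl⟩ := Finset.mem_image.1 ho
          exact hcon i
        have h2 := (Finset.card_le_card h1).trans Finset.card_image_le
        rw [Finset.card_image_of_injective _ (Option.some_injective _), Finset.card_univ,
          Fintype.card_fin] at h2
        omega
      obtain ⟨i, hi⟩ := this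
      refine ⟨_, GreedyRun.select V c x i run left room fun y hy hyx hc => hi ?_⟩
      exact Finset.mem_image.2 ⟨y, Finset.mem_filter.2 ⟨hy, hyx, by simp [hc]⟩, hc⟩
    · exact ⟨c, GreedyRun.skip V c x run left (not_lt.1 room)⟩

/-- Two points of a window of length `r` are at distance at most `r`, so the window is a clique and
its points get distinct colours. -/
theorem window_card_le_of_colorable {k : ℕ} {r : ℝ} {V : Finset ℝ} {S : Finset (V : Set ℝ)}
    (hS : ((geomGraph r (V : Set ℝ)).induce (S : Set (V : Set ℝ))).Colorable k) (x : ℝ) :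
    ((S.map (Function.Embedding.subtype _)).filter fun y => x - r ≤ y ∧ y ≤ x).card ≤ k := by
  obtain ⟨C⟩ := hS
  set T := S.filter fun y : (V : Set ℝ) => x - r ≤ (y : ℝ) ∧ (y : ℝ) ≤ x
  have h1 : ((S.map (Function.Embedding.subtype _)).filter fun y => x - r ≤ y ∧ y ≤ x)
      = T.map (Function.Embedding.subtype _) := by
    rw [Finset.filter_map]; rfl
  rw [h1, Finset.card_map, ← Finset.card_attach]
  have hmem : ∀ y : T, (y : (V : Set ℝ)) ∈ (S : Set (V : Set ℝ)) :=
    fun y => (Finset.mem_filter.1 y.2).1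
  refine (Finset.card_le_card_of_injOn (s := T.attach)
    (t := (Finset.univ : Finset (Fin k))) (fun y => C ⟨y, hmem y⟩) (by simp) ?_).trans_eq (by simp)
  intro y _ z _ hyz
  by_contra hne
  refine C.valid (v := ⟨y, hmem y⟩) (w := ⟨z, hmem z⟩) ?_ hyz
  rw [SimpleGraph.comap_adj]
  refine ⟨fun h => hne (Subtype.ext h), ?_⟩
  have hy := (Finset.mem_filter.1 y.2).2
  have hz := (Finset.mem_filter.1 z.2).2
  rw [Real.dist_eq, abs_le]
  constructor
  · have := hy.1; have := hz.2
    simp only [Function.Embedding.subtype_apply]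
    linarith
  · have := hz.1; have := hy.2
    simp only [Function.Embedding.subtype_apply]
    linarith

theorem GreedyRun.card_colouredPart {k : ℕ} {V : Finset ℝ} {c : ℝ → Option (Fin k)}
    (h : GreedyRun k V c) : (colouredPart V c).card = colourNumber k 1 (V : Set ℝ) := by
  -- Used twice: for the upper bound, and for the boundedness without which `sSup` in `ℕ` would take
  -- its default value.
  have hub : ∀ n ∈ {n : ℕ | ∃ S : Finset (V : Set ℝ),
      ((geomGraph 1 (V : Set ℝ)).induce (S : Set (V : Set ℝ))).Colorable k ∧ S.card = n},
      n ≤ (colouredPart V c).card := by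
    rintro n ⟨S, hS, rfl⟩
    rw [← Finset.card_map (Function.Embedding.subtype _)]
    refine h.isGreedySelection.card_le zero_le_one ?_ fun x _ => window_card_le_of_colorable hS x
    intro y hy
    obtain ⟨z, -, rfl⟩ := Finset.mem_map.1 hy
    exact z.2
  refine le_antisymm (le_csSup ⟨_, hub⟩ ?_) (csSup_le ⟨0, ∅, ?_, rfl⟩ hub)
  · refine ⟨(colouredPart V c).subtype (· ∈ (V : Set ℝ)), ?_, ?_⟩
    · have hcol : ∀ u : (((colouredPart V c).subtype (· ∈ (V : Set ℝ)) :
          Finset (V : Set ℝ)) : Set (V : Set ℝ)), (c (u : (V : Set ℝ))).isSome := fun u => by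
        have := u.2
        rw [Finset.mem_coe, Finset.mem_subtype] at this
        exact Option.isSome_iff_ne_none.2 (Finset.mem_filter.1 this).2
      refine ⟨SimpleGraph.Coloring.mk (fun u => (c (u : (V : Set ℝ))).get (hcol u)) ?_⟩
      intro u v huv heq
      rw [SimpleGraph.comap_adj] at huv
      refine h.isProperOn u v huv (Option.isSome_iff_ne_none.1 (hcol u)) ?_
      rw [← Option.some_get (hcol u), ← Option.some_get (hcol v), heq]
    · rw [Finset.card_subtype, Finset.filter_true_of_mem]
      intro x hx
      exact (Finset.mem_filter.1 hx).1
  · exact ⟨SimpleGraph.Coloring.mk (fun u => absurd u.2 (by simp))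
      fun {u} => absurd u.2 (by simp)⟩

/-! ### The Erlang loss system as a greedy selection -/

/-- After the arrivals in the increasing list `l`, the admitted customers form the greedy
selection, and the customers in service are the admitted ones that have not yet departed. -/
theorem lossStep_foldl_spec (k : ℕ) (σ : ℝ) (l : List ℝ) (hl : l.Pairwise (· < ·)) :
    let s := l.foldl (lossStep k σ) ⟨0, ∅⟩
    IsGreedySelection k σ l.toFinset s.admitted ∧
      ∀ x, (∀ y ∈ l, y < x) → (s.inService.filter fun e => x ≤ e).card
        = (s.admitted.filter fun y => x - σ ≤ y).card := by
  induction l using List.reverseRecOn with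
  | nil => exact ⟨by simpa using isGreedySelection_empty k σ, by simp⟩
  | append_singleton l a ih =>
    rw [List.pairwise_append] at hl
    obtain ⟨ih1, ih2⟩ := ih hl.1
    have hla : ∀ y ∈ l, y < a := fun y hy => hl.2.2 y hy a (by simp)
    have hla' : ∀ y ∈ l.toFinset, y < a := by simpa using hla
    rw [List.foldl_append, List.foldl_cons, List.foldl_nil]
    set s := l.foldl (lossStep k σ) ⟨0, ∅⟩
    have hset : (l ++ [a]).toFinset = insert a l.toFinset := by
      ext; simp
    -- Customers discarded at time `a` would have left before any later time `x` anyway, so the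
    -- purge at `a` does not affect later counts.
    have hfil : ∀ x, a < x → ((s.inService.filter fun e => a ≤ e).filter fun e => x ≤ e)
        = s.inService.filter fun e => x ≤ e := fun x hx => by
      rw [Multiset.filter_filter]
      exact Multiset.filter_congr fun e _ => ⟨fun h => h.1, fun h => ⟨h, hx.le.trans h⟩⟩
    have hcard := ih2 a hla
    have ha : a ∉ s.admitted := fun h => (hla' a (ih1.1 h)).false
    rw [hset]
    unfold lossStep
    by_cases hk : (s.inService.filter fun e => a ≤ e).card < k
    · simp only [hk, if_true]
      refine ⟨ih1.insert_of_lt hla' (hcard ▸ hk), fun x hx => ?_⟩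
      have hax : a < x := hx a (by simp)
      have hx' : ∀ y ∈ l, y < x := fun y hy => hx y (by simp [hy])
      rw [Finset.filter_insert]
      by_cases hxa : x ≤ a + σ
      · rw [Multiset.filter_cons_of_pos _ hxa, hfil x hax, Multiset.card_cons, ih2 x hx',
          if_pos (by linarith), Finset.card_insert_of_notMem (by simp [ha])]
      · rw [Multiset.filter_cons_of_neg _ hxa, hfil x hax, ih2 x hx', if_neg (by linarith)]
    · simp only [hk, if_false]
      refine ⟨ih1.insert_of_le hla' (hcard ▸ not_lt.1 hk), fun x hx => ?_⟩
      rw [hfil x (hx a (by simp)), ih2 x fun y hy => hx y (by simp [hy])]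

theorem isGreedySelection_erlangAdmitted (k : ℕ) (σ : ℝ) (V : Finset ℝ) :
    IsGreedySelection k σ V (erlangAdmitted k σ V) := by
  have := (lossStep_foldl_spec k σ (V.sort (· ≤ ·)) (Finset.sortedLT_sort V).pairwise).1
  rwa [Finset.sort_toFinset] at this

theorem GreedyRun.colouredPart_eq {k : ℕ} {V : Finset ℝ} {c : ℝ → Option (Fin k)}
    (h : GreedyRun k V c) : colouredPart V c = erlangAdmitted k 1 V :=
  h.isGreedySelection.unique (isGreedySelection_erlangAdmitted k 1 V)

theorem colourNumber_eq_card_erlangAdmitted (k : ℕ) (V : Finset ℝ) :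
    colourNumber k 1 (V : Set ℝ) = (erlangAdmitted k 1 V).card := by
  obtain ⟨c, h⟩ := exists_greedyRun k V
  rw [← h.card_colouredPart, h.colouredPart_eq]

/-! ### The slotted loss system and its coupling -/

/-- The number of admissions, in slotted time, of a loss system with capacity `k` in which a
customer blocks the `w` slots following its own. The list `h` is the history of admissions, most
recent slot first, and `b` tells in which of the following slots there is an arrival. -/
def slotAdmissions (k w : ℕ) : List Bool → List Bool → ℕ
  | _, [] => 0
  | h, false :: b => slotAdmissions k w (false :: h) b
  | h, true :: b =>
    if (h.take w).count true < k then slotAdmissions k w (true :: h) b + 1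
    else slotAdmissions k w (false :: h) b

theorem slotAdmissions_le_count (k w : ℕ) (h b : List Bool) :
    slotAdmissions k w h b ≤ b.count true := by
  induction b generalizing h with
  | nil => simp [slotAdmissions]
  | cons c b ih =>
    cases c
    · simpa [slotAdmissions] using ih (false :: h)
    · have h1 := ih (true :: h)
      have h2 := ih (false :: h)
      simp only [slotAdmissions, List.count_cons_self]
      split_ifs <;> omega

/-- If the cumulative number of admissions along one history dominates that along another one
over the whole window, then it does so at all later times. -/
theorem slotAdmissions_coupling (k w : ℕ) (b h h' : List Bool) (c c' : ℕ)
    (H : ∀ j ≤ w, c' + (h.take j).count true ≤ c + (h'.take j).count true) :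
    c' + slotAdmissions k w h' b ≤ c + slotAdmissions k w h b := by
  induction b generalizing h h' c c' with
  | nil => simpa [slotAdmissions] using H 0 (Nat.zero_le _)
  | cons x b ih =>
    have h0 : c' ≤ c := by simpa using H 0 (Nat.zero_le _)
    have hw := H w le_rfl
    have step : ∀ y y' : Bool, c' + y'.toNat ≤ c + y.toNat →
        c' + y'.toNat + slotAdmissions k w (y' :: h') b
          ≤ c + y.toNat + slotAdmissions k w (y :: h) b := by
      intro y y' hy
      refine ih _ _ _ _ fun j hj => ?_
      cases j with
      | zero => simpa using hy
      | succ j =>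
        have := H j (by omega)
        cases y <;> cases y' <;> simp <;> omega
    cases x
    · simpa [slotAdmissions] using step false false (by simpa using h0)
    · simp only [slotAdmissions]
      split_ifs with h1 h2 h2
      · have := step true true (by simpa using h0)
        simp only [Bool.toNat_true] at this
        omega
      -- The only dangerous case: the dominated system admits and the dominating one is full. Then
      -- the window of `h` has at least `k` admissions and that of `h'` fewer, so `H w` forces `c' <
      -- c`, leaving room for the extra admission.
      · have := step false true (by simp only [Bool.toNat_true, Bool.toNat_false]; omega)
        simp only [Bool.toNat_true, Bool.toNat_false] at this
        omega
      · have := step true false (by simp only [Bool.toNat_true, Bool.toNat_false]; omega)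
        simp only [Bool.toNat_true, Bool.toNat_false] at this
        omega
      · simpa using step false false (by simpa using h0)

theorem slotAdmissions_congr (k w : ℕ) (b h h' : List Bool) (H : h.take w = h'.take w) :
    slotAdmissions k w h b = slotAdmissions k w h' b := by
  have key : ∀ j ≤ w, h.take j = h'.take j := fun j hj => by
    have := congrArg (List.take j) H
    rwa [List.take_take, List.take_take, min_eq_left hj] at this
  apply le_antisymm
  · simpa using slotAdmissions_coupling k w b h' h 0 0 fun j hj => by rw [key j hj]
  · simpa using slotAdmissions_coupling k w b h h' 0 0 fun j hj => by rw [key j hj]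

theorem slotAdmissions_le_nil (k w : ℕ) (h b : List Bool) :
    slotAdmissions k w h b ≤ slotAdmissions k w [] b := by
  simpa using slotAdmissions_coupling k w b [] h 0 0 fun j _ => by simp

/-- The coupling with the roles exchanged: a head start of `k` compensates for the at most `k`
admissions in the window of `h`. -/
theorem slotAdmissions_nil_le (k w : ℕ) (h b : List Bool) (hh : (h.take w).count true ≤ k) :
    slotAdmissions k w [] b ≤ slotAdmissions k w h b + k := by
  have := slotAdmissions_coupling k w b h [] k 0 fun j hj => by
    have : (h.take j).count true ≤ (h.take w).count true :=
      (List.take_sublist_take_left hj).count_le _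
    simp
    omega
  omega

/-! ### Expectations and sums over lists of bits -/

/-- The expectation of `g` on lists of `M` independent bits that are `true` with probability
`p`. -/
noncomputable def bitE (p : ℝ) : ℕ → (List Bool → ℝ) → ℝ
  | 0, g => g []
  | M + 1, g => (1 - p) * bitE p M (fun b => g (false :: b)) + p * bitE p M (fun b => g (true :: b))

section bitE

variable {p : ℝ}

theorem bitE_add (M : ℕ) (f g : List Bool → ℝ) :
    bitE p M (fun b => f b + g b) = bitE p M f + bitE p M g := by
  induction M generalizing f g with
  | zero => rfl
  | succ M ih => simp only [bitE, ih]; ring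

theorem bitE_const_mul (M : ℕ) (a : ℝ) (f : List Bool → ℝ) :
    bitE p M (fun b => a * f b) = a * bitE p M f := by
  induction M generalizing f with
  | zero => rfl
  | succ M ih => simp only [bitE, ih]; ring

theorem bitE_const (M : ℕ) (a : ℝ) : bitE p M (fun _ => a) = a := by
  induction M with
  | zero => rfl
  | succ M ih => simp only [bitE, ih]; ring

theorem bitE_mono (h0 : 0 ≤ p) (h1 : p ≤ 1) (M : ℕ) {f g : List Bool → ℝ} (h : ∀ b, f b ≤ g b) :
    bitE p M f ≤ bitE p M g := by
  induction M generalizing f g with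
  | zero => exact h []
  | succ M ih =>
    have := sub_nonneg.2 h1
    simp only [bitE]
    gcongr
    · exact ih fun b => h _
    · exact ih fun b => h _

end bitE

/-- The sum of `f` over all lists of `n` bits. -/
noncomputable def bitSum : ℕ → (List Bool → ℝ) → ℝ
  | 0, f => f []
  | n + 1, f => bitSum n (fun l => f (false :: l)) + bitSum n (fun l => f (true :: l))

theorem bitSum_add (n : ℕ) (f g : List Bool → ℝ) :
    bitSum n (fun l => f l + g l) = bitSum n f + bitSum n g := by
  induction n generalizing f g with
  | zero => rfl
  | succ n ih => simp only [bitSum, ih]; ring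

theorem bitSum_const_mul (n : ℕ) (a : ℝ) (f : List Bool → ℝ) :
    bitSum n (fun l => a * f l) = a * bitSum n f := by
  induction n generalizing f with
  | zero => rfl
  | succ n ih => simp only [bitSum, ih]; ring

/-- Splits off the last entry, the oldest slot of a history, which is the one forgotten at each step
of the system. -/
theorem bitSum_succ' (n : ℕ) (f : List Bool → ℝ) :
    bitSum (n + 1) f
      = bitSum n (fun l => f (l ++ [false])) + bitSum n (fun l => f (l ++ [true])) := by
  induction n generalizing f with
  | zero => rfl
  | succ n ih =>
    rw [bitSum, ih, ih]
    simp only [bitSum, List.cons_append]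
    ring

theorem bitSum_congr (n : ℕ) {f g : List Bool → ℝ} (h : ∀ l, l.length = n → f l = g l) :
    bitSum n f = bitSum n g := by
  induction n generalizing f g with
  | zero => exact h [] rfl
  | succ n ih =>
    rw [bitSum, bitSum, ih fun l hl => h _ (by simp [hl]), ih fun l hl => h _ (by simp [hl])]

theorem bitSum_mono (n : ℕ) {f g : List Bool → ℝ} (h : ∀ l, l.length = n → f l ≤ g l) :
    bitSum n f ≤ bitSum n g := by
  induction n generalizing f g with
  | zero => exact h [] rfl
  | succ n ih =>
    rw [bitSum, bitSum]
    exact add_le_add (ih fun l hl => h _ (by simp [hl])) (ih fun l hl => h _ (by simp [hl]))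

theorem bitSum_count (n : ℕ) (f : ℕ → ℝ) :
    bitSum n (fun l => f (l.count true)) = ∑ m ∈ Finset.range (n + 1), (n.choose m : ℝ) * f m := by
  induction n generalizing f with
  | zero => simp [bitSum]
  | succ n ih =>
    rw [bitSum, Finset.sum_choose_succ_mul fun i _ => f i]
    simp only [List.count_cons_self, List.count_cons_of_ne (by decide : (false : Bool) ≠ true)]
    rw [ih, ih fun m => f (m + 1)]

theorem bitSum_count_lt (n K : ℕ) (r : ℝ) :
    bitSum n (fun l => if l.count true < K then r ^ l.count true else 0)
      = ∑ m ∈ Finset.range K, (n.choose m : ℝ) * r ^ m := by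
  rw [bitSum_count n fun m => if m < K then r ^ m else 0]
  simp only [mul_ite, mul_zero]
  rw [← Finset.sum_filter]
  have h1 : ((Finset.range (n + 1)).filter fun m => m < K) ⊆ Finset.range K := fun m hm => by
    simpa using (Finset.mem_filter.1 hm).2
  refine Finset.sum_subset h1 fun m hm hm' => ?_
  have : n < m := by
    by_contra hcon
    exact hm' (Finset.mem_filter.2 ⟨by simp; omega, by simpa using hm⟩)
  rw [Nat.choose_eq_zero_of_lt this]
  simp

/-! ### Stationary law of the slotted system -/

/-- The weight of a history of `w + 1` slots in the stationary distribution. -/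
noncomputable def histWeight (k : ℕ) (r : ℝ) (l : List Bool) : ℝ :=
  if l.count true < k + 1 then r ^ l.count true else 0

theorem histWeight_nonneg (k : ℕ) {r : ℝ} (hr : 0 ≤ r) (l : List Bool) : 0 ≤ histWeight k r l := by
  unfold histWeight
  split_ifs
  · positivity
  · rfl

/-- The total stationary weight. -/
noncomputable def histTotal (k w : ℕ) (r : ℝ) : ℝ :=
  ∑ m ∈ Finset.range (k + 1), ((w + 1).choose m : ℝ) * r ^ m

/-- The stationary admission rate per slot. -/
noncomputable def slotRate (k w : ℕ) (r : ℝ) : ℝ :=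
  r * (∑ m ∈ Finset.range k, (w.choose m : ℝ) * r ^ m) / histTotal k w r

theorem histTotal_eq (k w : ℕ) (r : ℝ) : bitSum (w + 1) (histWeight k r) = histTotal k w r :=
  bitSum_count_lt (w + 1) (k + 1) r

theorem histTotal_pos (k w : ℕ) {r : ℝ} (hr : 0 ≤ r) : 0 < histTotal k w r := by
  unfold histTotal
  rw [Finset.sum_range_succ']
  have : 0 ≤ ∑ m ∈ Finset.range k, ((w + 1).choose (m + 1) : ℝ) * r ^ (m + 1) :=
    Finset.sum_nonneg fun m _ => by positivity
  simp only [Nat.choose_zero_right, Nat.cast_one, pow_zero, mul_one]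
  linarith

/-- One step of the slotted loss system. -/
noncomputable def slotStep (k w : ℕ) (p : ℝ) (f : List Bool → ℝ) (l : List Bool) : ℝ :=
  (1 - p) * f (false :: l) +
    p * (if (l.take w).count true < k then f (true :: l) else f (false :: l))

/-- The probability of an admission in the next slot. -/
noncomputable def admitProb (k w : ℕ) (p : ℝ) (l : List Bool) : ℝ :=
  if (l.take w).count true < k then p else 0

/-- Stationarity. Histories have `w + 1` slots although only `w` of them block: an admission is
allowed exactly when the enlarged history still has at most `k` admissions. Write a history as `l ++
[a]` and let `c` be the count of `l`. If `c < k`, summing over `a` gives mass `r ^ c * (1 + r)`,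
which splits into `r ^ c` for `false :: l` and `r ^ (c + 1)` for `true :: l`. If `c = k`, only `a =
false` has weight, and all of it moves to `false :: l`. -/
theorem bitSum_histWeight_slotStep (k w : ℕ) {p r : ℝ} (hr : r * (1 - p) = p)
    {f : List Bool → ℝ} (hf : ∀ l l' : List Bool, l.take (w + 1) = l'.take (w + 1) → f l = f l') :
    bitSum (w + 1) (fun l => histWeight k r l * slotStep k w p f l)
      = bitSum (w + 1) (fun l => histWeight k r l * f l) := by
  rw [bitSum_succ', ← bitSum_add, bitSum, ← bitSum_add]
  refine bitSum_congr w fun l hl => ?_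
  have hq : (1 - p) * (1 + r) = 1 := by linarith
  have hp : p * (1 + r) = r := by linarith
  have htake : ∀ a, (l ++ [a]).take w = l := fun a => by rw [← hl]; simp
  have hf' : ∀ x a, f (x :: (l ++ [a])) = f (x :: l) := fun x a => by
    apply hf
    rw [List.take_succ_cons, List.take_succ_cons, htake, ← hl, List.take_length]
  have c1 : ∀ a, (l ++ [a]).count true = (a :: l).count true := fun a => by
    simp [List.count_append, List.count_cons]
  simp only [histWeight, slotStep, htake, hf', c1]
  simp only [List.count_cons_self, List.count_cons_of_ne (by decide : (false : Bool) ≠ true)]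
  rcases lt_trichotomy (l.count true) k with h | h | h
  · simp only [h, if_pos (by omega : l.count true < k + 1),
      if_pos (by omega : l.count true + 1 < k + 1), if_true, pow_succ]
    linear_combination (r ^ l.count true * f (false :: l)) * hq
      + (r ^ l.count true * f (true :: l)) * hp
  · rw [if_pos (by omega), if_neg (by omega), if_neg (by omega)]
    ring
  · simp only [if_neg (by omega : ¬ l.count true < k + 1),
      if_neg (by omega : ¬ l.count true + 1 < k + 1)]
    ring

/-- Summing out the oldest slot turns the weight `r ^ c` of the `w` blocking slots into `r ^ c * (1
+ r)`, and `p * (1 + r) = r`. -/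
theorem bitSum_histWeight_admitProb (k w : ℕ) {p r : ℝ} (hr0 : 0 ≤ r) (hr : r * (1 - p) = p) :
    bitSum (w + 1) (fun l => histWeight k r l * admitProb k w p l)
      = histTotal k w r * slotRate k w r := by
  rw [slotRate, mul_div_cancel₀ _ (histTotal_pos k w hr0).ne', ← bitSum_count_lt,
    ← bitSum_const_mul, bitSum_succ', ← bitSum_add]
  refine bitSum_congr w fun l hl => ?_
  have hp : p * (1 + r) = r := by linarith
  have htake : ∀ a, (l ++ [a]).take w = l := fun a => by rw [← hl]; simp
  have c1 : ∀ a, (l ++ [a]).count true = (a :: l).count true := fun a => by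
    simp [List.count_append, List.count_cons]
  simp only [histWeight, admitProb, htake, c1]
  simp only [List.count_cons_self, List.count_cons_of_ne (by decide : (false : Bool) ≠ true)]
  by_cases h : l.count true < k
  · simp only [h, if_pos (by omega : l.count true < k + 1),
      if_pos (by omega : l.count true + 1 < k + 1), if_true, pow_succ]
    linear_combination r ^ l.count true * hp
  · rw [if_neg h, if_neg h]
    ring

/-- The mean number of admissions in `M` slots after the history `h`. -/
noncomputable def meanSlotAdmissions (k w : ℕ) (p : ℝ) (M : ℕ) (h : List Bool) : ℝ :=
  bitE p M fun b => (slotAdmissions k w h b : ℝ)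

theorem meanSlotAdmissions_succ (k w : ℕ) (p : ℝ) (M : ℕ) (h : List Bool) :
    meanSlotAdmissions k w p (M + 1) h
      = admitProb k w p h + slotStep k w p (meanSlotAdmissions k w p M) h := by
  unfold meanSlotAdmissions admitProb slotStep
  simp only [bitE, slotAdmissions]
  split_ifs with hk
  · simp only [Nat.cast_add, Nat.cast_one, bitE_add, bitE_const]
    ring
  · ring

/-- By stationarity every slot contributes the same expected number of admissions, so the mean is
exactly linear in `M`. -/
theorem bitSum_histWeight_mean (k w : ℕ) {p r : ℝ} (hr0 : 0 ≤ r) (hr : r * (1 - p) = p) (M : ℕ) :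
    bitSum (w + 1) (fun l => histWeight k r l * meanSlotAdmissions k w p M l)
      = histTotal k w r * (M * slotRate k w r) := by
  induction M with
  | zero =>
    have : ∀ l, meanSlotAdmissions k w p 0 l = 0 := fun l => by
      simp [meanSlotAdmissions, bitE, slotAdmissions]
    simp only [this]
    rw [bitSum_congr (g := fun l => 0 * histWeight k r l) _ fun l _ => by ring, bitSum_const_mul]
    simp
  | succ M ih =>
    simp only [meanSlotAdmissions_succ, mul_add]
    rw [bitSum_add, bitSum_histWeight_admitProb k w hr0 hr, bitSum_histWeight_slotStep k w hr, ih]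
    · push_cast; ring
    · intro l l' hll
      unfold meanSlotAdmissions
      congr 1
      ext b
      rw [slotAdmissions_congr]
      have := congrArg (List.take w) hll
      simpa [List.take_take] using this

/-! ### Mean and second moment from a given start -/

section Bounds

variable {p r : ℝ} (k w : ℕ)

theorem slotRate_nonneg (hr0 : 0 ≤ r) : 0 ≤ slotRate k w r := by
  have := histTotal_pos k w hr0
  unfold slotRate
  have : 0 ≤ ∑ m ∈ Finset.range k, (w.choose m : ℝ) * r ^ m :=
    Finset.sum_nonneg fun m _ => by positivity
  positivity

theorem slotRate_le (hp0 : 0 ≤ p) (hr0 : 0 ≤ r) (hr : r * (1 - p) = p) : slotRate k w r ≤ p := by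
  refine le_of_mul_le_mul_left ?_ (histTotal_pos k w hr0)
  rw [← bitSum_histWeight_admitProb k w hr0 hr, ← histTotal_eq, mul_comm, ← bitSum_const_mul]
  refine bitSum_mono _ fun l _ => ?_
  rw [mul_comm p]
  refine mul_le_mul_of_nonneg_left ?_ (histWeight_nonneg k hr0 l)
  unfold admitProb
  split_ifs
  · rfl
  · exact hp0

/-- The stationary mean averages over starts, and the empty start dominates each of them. -/
theorem mul_slotRate_le_mean_nil (hp0 : 0 ≤ p) (hp1 : p ≤ 1) (hr0 : 0 ≤ r)
    (hr : r * (1 - p) = p) (M : ℕ) : M * slotRate k w r ≤ meanSlotAdmissions k w p M [] := by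
  refine le_of_mul_le_mul_left ?_ (histTotal_pos k w hr0)
  rw [← bitSum_histWeight_mean k w hr0 hr, ← histTotal_eq, mul_comm, ← bitSum_const_mul]
  refine bitSum_mono _ fun l _ => ?_
  rw [mul_comm _ (histWeight k r l)]
  refine mul_le_mul_of_nonneg_left ?_ (histWeight_nonneg k hr0 l)
  exact bitE_mono hp0 hp1 M fun b => by exact_mod_cast slotAdmissions_le_nil k w l b

theorem mean_nil_le (hp0 : 0 ≤ p) (hp1 : p ≤ 1) (hr0 : 0 ≤ r)
    (hr : r * (1 - p) = p) (M : ℕ) :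
    meanSlotAdmissions k w p M [] ≤ M * slotRate k w r + k := by
  rw [← sub_le_iff_le_add]
  refine le_of_mul_le_mul_left ?_ (histTotal_pos k w hr0)
  rw [← bitSum_histWeight_mean k w hr0 hr, ← histTotal_eq, mul_comm, ← bitSum_const_mul]
  refine bitSum_mono _ fun l _ => ?_
  by_cases hl : l.count true < k + 1
  · rw [mul_comm _ (histWeight k r l)]
    refine mul_le_mul_of_nonneg_left ?_ (histWeight_nonneg k hr0 l)
    rw [sub_le_iff_le_add]
    unfold meanSlotAdmissions
    rw [← bitE_const (p := p) M (k : ℝ), ← bitE_add]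
    refine bitE_mono hp0 hp1 M fun b => ?_
    have h1 : (l.take w).count true ≤ l.count true := (List.take_sublist _ _).count_le _
    exact_mod_cast slotAdmissions_nil_le k w l b (by omega)
  · simp [histWeight, hl]

/-- Both the mean from `h` and `M * slotRate k w r` lie between the mean from the empty start minus
`k` and that mean itself. -/
theorem abs_mean_sub_le (hp0 : 0 ≤ p) (hp1 : p ≤ 1) (hr0 : 0 ≤ r)
    (hr : r * (1 - p) = p) (M : ℕ) (h : List Bool) (hh : (h.take w).count true ≤ k) :
    |meanSlotAdmissions k w p M h - M * slotRate k w r| ≤ k := by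
  have h1 := mul_slotRate_le_mean_nil k w hp0 hp1 hr0 hr M
  have h2 := mean_nil_le k w hp0 hp1 hr0 hr M
  have h3 : meanSlotAdmissions k w p M h ≤ meanSlotAdmissions k w p M [] :=
    bitE_mono hp0 hp1 M fun b => by exact_mod_cast slotAdmissions_le_nil k w h b
  have h4 : meanSlotAdmissions k w p M [] ≤ meanSlotAdmissions k w p M h + k := by
    unfold meanSlotAdmissions
    rw [← bitE_const (p := p) M (k : ℝ), ← bitE_add]
    exact bitE_mono hp0 hp1 M fun b => by exact_mod_cast slotAdmissions_nil_le k w h b hh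
  rw [abs_le]
  constructor <;> linarith

/-- The second moment of the number of admissions in `M` slots, centred at its stationary mean. -/
theorem secondMoment_le (hp0 : 0 ≤ p) (hp1 : p ≤ 1) (hr0 : 0 ≤ r)
    (hr : r * (1 - p) = p) (M : ℕ) (h : List Bool) (hh : (h.take w).count true ≤ k) :
    bitE p M (fun b => ((slotAdmissions k w h b : ℝ) - M * slotRate k w r) ^ 2)
      ≤ M * (p * (4 * k + 2)) := by
  induction M generalizing h with
  | zero => simp [bitE, slotAdmissions]
  | succ M ih =>
    set ρ := slotRate k w r
    have hρ0 : 0 ≤ ρ := slotRate_nonneg k w hr0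
    have hρp : ρ ≤ p := slotRate_le k w hp0 hr0 hr
    -- Moving the centre by `d` costs `2 * d * (mean - M * ρ) + d ^ 2`, and the bias is at most `k`.
    -- After the first slot, `d = -ρ` without an admission and `d = 1 - ρ` with one.
    have shift : ∀ (h : List Bool) (d : ℝ), (h.take w).count true ≤ k →
        bitE p M (fun b => ((slotAdmissions k w h b : ℝ) - M * ρ + d) ^ 2)
          ≤ M * (p * (4 * k + 2)) + (2 * k * |d| + d ^ 2) := by
      intro h d hh
      have e : bitE p M (fun b => ((slotAdmissions k w h b : ℝ) - M * ρ + d) ^ 2)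
          = bitE p M (fun b => ((slotAdmissions k w h b : ℝ) - M * ρ) ^ 2)
            + (2 * d * (meanSlotAdmissions k w p M h - M * ρ) + d ^ 2) := by
        rw [meanSlotAdmissions, sub_eq_add_neg, ← bitE_const (p := p) M (-(M * ρ)), ← bitE_add,
          ← bitE_const_mul, ← bitE_const (p := p) M (d ^ 2), ← bitE_add, ← bitE_add]
        congr 1
        ext b
        ring
      rw [e]
      have h1 := abs_mean_sub_le k w hp0 hp1 hr0 hr M h hh
      have h2 : 2 * d * (meanSlotAdmissions k w p M h - M * ρ) ≤ 2 * k * |d| := by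
        refine (le_abs_self _).trans ?_
        rw [abs_mul, abs_mul, abs_two]
        nlinarith [mul_le_mul_of_nonneg_left h1 (abs_nonneg d)]
      linarith [ih h hh]
    have hk0 : (0 : ℝ) ≤ k := Nat.cast_nonneg k
    have hcount : ∀ (x : Bool), ((x :: h).take w).count true ≤ (h.take w).count true + x.toNat := by
      intro x
      cases w with
      | zero => simp
      | succ w =>
        have h1 : (h.take w).count true ≤ (h.take (w + 1)).count true :=
          (List.take_sublist_take_left (Nat.le_succ w)).count_le _
        cases x <;> simp <;> omega
    have hf := shift (false :: h) (-ρ) ((hcount false).trans (by simpa using hh))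
    rw [abs_neg, abs_of_nonneg hρ0] at hf
    have hf' : bitE p M (fun b => ((slotAdmissions k w (false :: h) b : ℝ)
        - (M + 1 : ℕ) * ρ) ^ 2) ≤ M * (p * (4 * k + 2)) + p * (2 * k + 1) := by
      have e : (fun b => ((slotAdmissions k w (false :: h) b : ℝ) - (M + 1 : ℕ) * ρ) ^ 2)
          = fun b => ((slotAdmissions k w (false :: h) b : ℝ) - M * ρ + -ρ) ^ 2 := by
        ext b; push_cast; ring
      rw [e]
      refine hf.trans ?_
      nlinarith
    have hq : 0 ≤ 1 - p := by linarith
    simp only [bitE, slotAdmissions]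
    by_cases hk : (h.take w).count true < k
    · simp only [hk, if_true]
      have ht := shift (true :: h) (1 - ρ) ((hcount true).trans (by simpa using hk))
      rw [abs_of_nonneg (by linarith : 0 ≤ 1 - ρ)] at ht
      have ht' : bitE p M (fun b => (((slotAdmissions k w (true :: h) b + 1 : ℕ) : ℝ)
          - (M + 1 : ℕ) * ρ) ^ 2) ≤ M * (p * (4 * k + 2)) + (2 * k + 1) := by
        have e : (fun b => (((slotAdmissions k w (true :: h) b + 1 : ℕ) : ℝ)
            - (M + 1 : ℕ) * ρ) ^ 2)
            = fun b => ((slotAdmissions k w (true :: h) b : ℝ) - M * ρ + (1 - ρ)) ^ 2 := by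
          ext b; push_cast; ring
        rw [e]
        refine ht.trans ?_
        nlinarith
      -- The cost is at most `p * (2 * k + 1)` without an admission, because `ρ ≤ p ≤ 1`, and at
      -- most `2 * k + 1` with one, which has probability `p`. Together this is at most `p * (4 * k
      -- + 2)`. The factor `p` is essential: it keeps the total bounded as the slots shrink.
      have a1 := mul_le_mul_of_nonneg_left hf' hq
      have a2 := mul_le_mul_of_nonneg_left ht' hp0
      have a3 : 0 ≤ p * (p * (2 * k + 1)) := by positivity
      push_cast at a1 a2 ⊢
      nlinarith
    · simp only [hk, if_false]
      have a3 : 0 ≤ p * (2 * k + 1) := by positivity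
      push_cast at hf' ⊢
      nlinarith

end Bounds

/-! ### From real arrival times to slots -/

/-- If the points of `V` can be assigned to distinct slots compatibly with the order and with the
window, then the greedy selection has as many points as there are admissions in slotted time. -/
theorem IsGreedySelection.card_eq_slotAdmissions {k w n : ℕ} {V A : Finset ℝ}
    (hA : IsGreedySelection k 1 V A) (φ : ℝ → ℕ)
    (hφ : ∀ x ∈ V, ∀ y ∈ V, y < x → φ y < φ x)
    (hw : ∀ x ∈ V, ∀ y ∈ V, y < x → (x - 1 ≤ y ↔ φ x ≤ φ y + w)) (hn : ∀ x ∈ V, φ x < n) :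
    A.card = slotAdmissions k w [] (List.ofFn fun j : Fin n => decide (∃ x ∈ V, φ x = j)) := by
  have hlt : ∀ x ∈ V, ∀ y ∈ V, φ y < φ x → y < x := fun x hx y hy h => by
    by_contra hcon
    rcases eq_or_lt_of_le (not_lt.1 hcon) with rfl | h'
    · exact h.false
    · exact (hφ y hy x hx h').not_gt h
  -- Induction on the number `m` of remaining slots. The invariant is that the history `h` seen at
  -- slot `i` records, in every initial segment, the selected points in the corresponding preceding
  -- slots.
  have key : ∀ m i : ℕ, ∀ h : List Bool, i + m = n →
      (∀ j, (h.take j).count true = (A.filter fun x => φ x < i ∧ i ≤ φ x + j).card) →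
      slotAdmissions k w h (List.ofFn fun j : Fin m => decide (∃ x ∈ V, φ x = i + j))
        = (A.filter fun x => i ≤ φ x).card := by
    intro m
    induction m with
    | zero =>
      intro i h him _
      rw [Finset.filter_false_of_mem, List.ofFn_zero]
      · rfl
      · intro x hx
        have := hn x (hA.1 hx)
        omega
    | succ m ih =>
      intro i h him hh
      have htail : (List.ofFn fun j : Fin m => decide (∃ x ∈ V, φ x = i + (j.succ : Fin (m + 1))))
          = List.ofFn fun j : Fin m => decide (∃ x ∈ V, φ x = i + 1 + j) := by
        congr 1
        ext j
        simp only [Fin.val_succ]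
        congr! 4
        omega
      rw [List.ofFn_succ, htail]
      simp only [Fin.val_zero, add_zero]
      by_cases hx : ∃ x ∈ A, φ x = i
      · obtain ⟨x, hxA, hxi⟩ := hx
        have hxV := hA.1 hxA
        have huniq : ∀ y ∈ V, φ y = i → y = x := fun y hy hyi => by
          rcases lt_trichotomy y x with h | h | h
          · have := hφ x hxV y hy h; omega
          · exact h
          · have := hφ y hy x hxV h; omega
        have hwin : (h.take w).count true < k := by
          rw [hh w]
          refine lt_of_le_of_lt (Finset.card_le_card ?_) ((hA.2 x hxV).1 hxA)
          intro y hy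
          rw [Finset.mem_filter] at hy ⊢
          have hyx := hlt x hxV y (hA.1 hy.1) (by omega)
          exact ⟨hy.1, (hw x hxV y (hA.1 hy.1) hyx).2 (by omega), hyx⟩
        rw [decide_eq_true ⟨x, hxV, hxi⟩]
        simp only [slotAdmissions, hwin, if_true]
        rw [ih (i + 1) (true :: h) (by omega)]
        · have : (A.filter fun y => i ≤ φ y) = insert x (A.filter fun y => i + 1 ≤ φ y) := by
            ext y
            simp only [Finset.mem_filter, Finset.mem_insert]
            constructor
            · rintro ⟨hy, hyi⟩
              rcases eq_or_lt_of_le hyi with h | h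
              · exact Or.inl (huniq y (hA.1 hy) h.symm)
              · exact Or.inr ⟨hy, h⟩
            · rintro (rfl | ⟨hy, hyi⟩)
              · exact ⟨hxA, hxi.ge⟩
              · exact ⟨hy, by omega⟩
          rw [this, Finset.card_insert_of_notMem]
          simp [hxi]
        · intro j
          cases j with
          | zero =>
            rw [Finset.filter_false_of_mem]
            · simp
            · intro y _; omega
          | succ j =>
            rw [List.take_succ_cons, List.count_cons_self, hh j]
            have : (A.filter fun y => φ y < i + 1 ∧ i + 1 ≤ φ y + (j + 1))
                = insert x (A.filter fun y => φ y < i ∧ i ≤ φ y + j) := by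
              ext y
              simp only [Finset.mem_filter, Finset.mem_insert]
              constructor
              · rintro ⟨hy, hyi, hyj⟩
                rcases eq_or_lt_of_le (Nat.lt_succ_iff.1 hyi) with h | h
                · exact Or.inl (huniq y (hA.1 hy) h)
                · exact Or.inr ⟨hy, h, by omega⟩
              · rintro (rfl | ⟨hy, hyi⟩)
                · exact ⟨hxA, by omega, by omega⟩
                · exact ⟨hy, by omega, by omega⟩
            rw [this, Finset.card_insert_of_notMem]
            simp [hxi]
      · have hstep : slotAdmissions k w (false :: h)
            (List.ofFn fun j : Fin m => decide (∃ x ∈ V, φ x = i + 1 + j))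
            = (A.filter fun x => i ≤ φ x).card := by
          have hne : ∀ y ∈ A, φ y ≠ i := fun y hy hyi => hx ⟨y, hy, hyi⟩
          rw [ih (i + 1) (false :: h) (by omega)]
          · congr 1
            exact Finset.filter_congr fun y hy => by have := hne y hy; omega
          · intro j
            cases j with
            | zero =>
              rw [Finset.filter_false_of_mem]
              · simp
              · intro y _; omega
            | succ j =>
              rw [List.take_succ_cons, List.count_cons_of_ne (by decide), hh j]
              congr 1
              exact Finset.filter_congr fun y hy => by have := hne y hy; omega
        rw [← hstep]
        by_cases hV : ∃ x ∈ V, φ x = i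
        · rw [decide_eq_true hV]
          obtain ⟨x, hxV, hxi⟩ := hV
          have hxA : x ∉ A := fun h => hx ⟨x, h, hxi⟩
          have hwin : ¬ (h.take w).count true < k := by
            rw [hh w]
            refine fun hlt' => hxA ((hA.2 x hxV).2 (lt_of_le_of_lt (Finset.card_le_card ?_) hlt'))
            intro y hy
            rw [Finset.mem_filter] at hy ⊢
            have h1 := hφ x hxV y (hA.1 hy.1) hy.2.2
            have h2 := (hw x hxV y (hA.1 hy.1) hy.2.2).1 hy.2.1
            exact ⟨hy.1, by omega, by omega⟩
          simp only [slotAdmissions, hwin, if_false]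
        · rw [decide_eq_false hV]
          rfl
  have := key n 0 [] (by omega) (by simp)
  simp only [zero_le, Finset.filter_true, zero_add] at this
  exact this.symm

/-- Finitely many points are separated once slots are short. The ceiling handles the closed window
exactly: `x - 1 ≤ y` gives `x * u ≤ y * u + ⌈u⌉₊`, including the case of distance exactly 1.
Conversely a gap beyond 1 grows to at least 2 slots, one absorbed by the ceiling and one giving
strictness. -/
theorem eventually_floor_slots (V : Finset ℝ) (hV : ∀ x ∈ V, 0 ≤ x) :
    ∀ᶠ u : ℝ in atTop, ∀ x ∈ V, ∀ y ∈ V, y < x → ⌊y * u⌋₊ < ⌊x * u⌋₊ ∧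
      (x - 1 ≤ y ↔ ⌊x * u⌋₊ ≤ ⌊y * u⌋₊ + ⌈u⌉₊) := by
  rw [Filter.eventually_all_finset]
  intro x hx
  rw [Filter.eventually_all_finset]
  intro y hy
  rw [Filter.eventually_imp_distrib_left]
  intro hyx
  have hy0 := hV y hy
  have h1 : ∀ᶠ u : ℝ in atTop, 1 ≤ (x - y) * u :=
    (tendsto_id.const_mul_atTop (sub_pos.2 hyx)).eventually_ge_atTop 1
  have h2 : ∀ᶠ u : ℝ in atTop, x - 1 ≤ y ∨ 2 ≤ (x - y - 1) * u := by
    by_cases hxy : x - 1 ≤ y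
    · exact Filter.Eventually.of_forall fun _ => Or.inl hxy
    · have h : 0 < x - y - 1 := by linarith [not_le.1 hxy]
      exact ((tendsto_id.const_mul_atTop h).eventually_ge_atTop 2).mono fun u hu => Or.inr hu
  filter_upwards [h1, h2, eventually_ge_atTop 0] with u hu1 hu2 hu0
  have hyu : 0 ≤ y * u := mul_nonneg hy0 hu0
  refine ⟨?_, ?_⟩
  · rw [← Nat.succ_le_iff, Nat.succ_eq_add_one, ← Nat.floor_add_one hyu]
    exact Nat.floor_le_floor (by linarith)
  · by_cases hxy : x - 1 ≤ y
    · refine iff_of_true hxy ?_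
      rw [← Nat.floor_add_natCast hyu]
      refine Nat.floor_le_floor ?_
      have := Nat.le_ceil u
      nlinarith
    · refine iff_of_false hxy ?_
      rw [not_le, ← Nat.succ_le_iff, Nat.succ_eq_add_one, ← Nat.floor_add_natCast hyu,
        ← Nat.floor_add_one (by positivity)]
      refine Nat.floor_le_floor ?_
      have := Nat.ceil_lt_add_one hu0
      have := hu2.resolve_left hxy
      linarith

/-! ### Limits -/

theorem tendsto_choose_mul_pow {N : ℕ → ℕ} {r : ℕ → ℝ} {a : ℝ} (hN : Tendsto N atTop atTop)
    (hr : Tendsto (fun n => (N n : ℝ) * r n) atTop (𝓝 a)) (m : ℕ) :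
    Tendsto (fun n => ((N n).choose m : ℝ) * r n ^ m) atTop (𝓝 (a ^ m / m.factorial)) := by
  have h1 := ((isEquivalent_choose m).comp_tendsto hN).mul
    (Asymptotics.IsEquivalent.refl (u := fun n => r n ^ m))
  refine h1.symm.tendsto_nhds (((hr.pow m).div_const (m.factorial : ℝ)).congr fun n => ?_)
  simp only [Pi.mul_apply, Function.comp_apply]
  ring

theorem tendsto_mul_exp_div_sub_one (c : ℝ) :
    Tendsto (fun n : ℕ => (n : ℝ) * (Real.exp (c / n) - 1)) atTop (𝓝 c) := by
  have h0 : Tendsto (fun n : ℕ => c ^ 2 / (n : ℝ)) atTop (𝓝 0) :=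
    tendsto_const_div_atTop_nhds_zero_nat _
  rw [tendsto_iff_dist_tendsto_zero]
  refine squeeze_zero' (Eventually.of_forall fun _ => dist_nonneg) ?_ h0
  have h1 : ∀ᶠ n : ℕ in atTop, |c / (n : ℝ)| ≤ 1 := by
    have : Tendsto (fun n : ℕ => |c / (n : ℝ)|) atTop (𝓝 0) := by
      simpa using (tendsto_const_div_atTop_nhds_zero_nat c).abs
    exact this.eventually_le_const one_pos
  filter_upwards [h1, eventually_gt_atTop 0] with n hn hn0
  have hn0' : (0 : ℝ) < n := Nat.cast_pos.2 hn0
  have h2 := Real.abs_exp_sub_one_sub_id_le hn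
  have h3 : (n : ℝ) * (Real.exp (c / n) - 1) - c = n * (Real.exp (c / n) - 1 - c / n) := by
    field_simp
  rw [Real.dist_eq, h3, abs_mul, abs_of_pos hn0']
  calc (n : ℝ) * |Real.exp (c / n) - 1 - c / n| ≤ n * (c / n) ^ 2 := by gcongr
    _ = c ^ 2 / n := by field_simp

theorem one_sub_erlangLoss {lam : ℝ} (hlam : 0 < lam) (k : ℕ) :
    1 - erlangLoss lam k = (∑ m ∈ Finset.range k, lam ^ m / (m.factorial : ℝ)) /
      ∑ l ∈ Finset.range (k + 1), lam ^ l / (l.factorial : ℝ) := by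
  have h : 0 < ∑ l ∈ Finset.range (k + 1), lam ^ l / (l.factorial : ℝ) :=
    Finset.sum_pos (fun _ _ => by positivity) ⟨0, by simp⟩
  rw [erlangLoss, one_sub_div h.ne']
  congr 1
  rw [Finset.sum_range_succ]
  ring

/-- With `w ~ n / t` and `r ~ λt / n` one has `w * r → λ`, so `(w.choose m) * r ^ m → λ ^ m / m!`,
while the prefactor `n * r` tends to `λt`. -/
theorem tendsto_mul_slotRate {lam t : ℝ} (hlam : 0 < lam) (ht : 0 < t) (k : ℕ) :
    Tendsto (fun n : ℕ => (n : ℝ) * slotRate k ⌈(n : ℝ) / t⌉₊ (Real.exp (lam * t / n) - 1)) atTop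
      (𝓝 (lam * t * (1 - erlangLoss lam k))) := by
  have hw : Tendsto (fun n : ℕ => ⌈(n : ℝ) / t⌉₊) atTop atTop :=
    tendsto_nat_ceil_atTop.comp (tendsto_natCast_atTop_atTop.atTop_div_const ht)
  have hr := tendsto_mul_exp_div_sub_one (lam * t)
  have hr0 : Tendsto (fun n : ℕ => Real.exp (lam * t / n) - 1) atTop (𝓝 0) := by
    have := (Real.continuous_exp.tendsto 0).comp (tendsto_const_div_atTop_nhds_zero_nat (lam * t))
    simpa using this.sub_const 1
  have hwn : Tendsto (fun n : ℕ => (⌈(n : ℝ) / t⌉₊ : ℝ) / n) atTop (𝓝 t⁻¹) := by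
    have := (tendsto_nat_ceil_mul_div_atTop (R := ℝ) (inv_nonneg.2 ht.le)).comp
      tendsto_natCast_atTop_atTop
    refine this.congr fun n => ?_
    simp only [Function.comp_apply]
    rw [inv_mul_eq_div]
  have hwr : Tendsto (fun n : ℕ => (⌈(n : ℝ) / t⌉₊ : ℝ) * (Real.exp (lam * t / n) - 1)) atTop
      (𝓝 lam) := by
    have := hwn.mul hr
    rw [show t⁻¹ * (lam * t) = lam by field_simp] at this
    refine this.congr' ?_
    filter_upwards [eventually_gt_atTop 0] with n hn
    have : (0 : ℝ) < n := Nat.cast_pos.2 hn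
    field_simp
  have hwr' : Tendsto (fun n : ℕ => ((⌈(n : ℝ) / t⌉₊ + 1 : ℕ) : ℝ) * (Real.exp (lam * t / n) - 1))
      atTop (𝓝 lam) := by
    have := hwr.add hr0
    rw [add_zero] at this
    refine this.congr fun n => ?_
    push_cast
    ring
  have hnum : Tendsto (fun n : ℕ => ∑ m ∈ Finset.range k,
      ((⌈(n : ℝ) / t⌉₊).choose m : ℝ) * (Real.exp (lam * t / n) - 1) ^ m) atTop
      (𝓝 (∑ m ∈ Finset.range k, lam ^ m / (m.factorial : ℝ))) :=
    tendsto_finsetSum _ fun m _ => tendsto_choose_mul_pow hw hwr m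
  have hden : Tendsto (fun n : ℕ => histTotal k ⌈(n : ℝ) / t⌉₊ (Real.exp (lam * t / n) - 1)) atTop
      (𝓝 (∑ m ∈ Finset.range (k + 1), lam ^ m / (m.factorial : ℝ))) :=
    tendsto_finsetSum _ fun m _ =>
      tendsto_choose_mul_pow ((tendsto_add_atTop_nat 1).comp hw) hwr' m
  have hpos : 0 < ∑ l ∈ Finset.range (k + 1), lam ^ l / (l.factorial : ℝ) :=
    Finset.sum_pos (fun _ _ => by positivity) ⟨0, by simp⟩
  have := (hr.mul hnum).div hden hpos.ne'
  rw [mul_div_assoc, ← one_sub_erlangLoss hlam] at this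
  refine this.congr fun n => ?_
  unfold slotRate
  simp only [Pi.div_apply]
  ring

/-! ### Independent bits -/

theorem sum_prod_eq_bitE (p : ℝ) (M : ℕ) (g : List Bool → ℝ) :
    ∑ b : Fin M → Bool, (∏ i, (if b i then p else 1 - p)) * g (List.ofFn b) = bitE p M g := by
  induction M generalizing g with
  | zero => simp [bitE]
  | succ M ih =>
    rw [← (Fin.consEquiv fun _ => Bool).sum_comp, Fintype.sum_prod_type, Fintype.sum_bool, bitE,
      ← ih, ← ih, Finset.mul_sum, Finset.mul_sum, add_comm]
    congr 1 <;> refine Finset.sum_congr rfl fun b _ => ?_ <;>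
      simp [Fin.consEquiv, Fin.prod_univ_succ, List.ofFn_succ, mul_assoc]

theorem integral_ofFn_eq_bitE {Ω : Type*} [MeasurableSpace Ω] {P : Measure Ω}
    [IsProbabilityMeasure P] {M : ℕ} {B : Fin M → Ω → Bool} (hB : ∀ i, Measurable (B i))
    (hind : iIndepFun B P) {p : ℝ} (hp : ∀ i, P.real (B i ⁻¹' {true}) = p) (g : List Bool → ℝ) :
    ∫ ω, g (List.ofFn fun i => B i ω) ∂P = bitE p M g := by
  have hm : Measurable fun ω i => B i ω := measurable_pi_lambda _ hB
  rw [← integral_map (φ := fun ω i => B i ω) (f := fun b : Fin M → Bool => g (List.ofFn b))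
    hm.aemeasurable .of_discrete]
  have : IsProbabilityMeasure (P.map fun ω i => B i ω) :=
    Measure.isProbabilityMeasure_map hm.aemeasurable
  rw [integral_fintype .of_finite, ← sum_prod_eq_bitE]
  refine Finset.sum_congr rfl fun b _ => ?_
  rw [smul_eq_mul]
  congr 1
  rw [(iIndepFun_iff_map_fun_eq_pi_map fun i => (hB i).aemeasurable).1 hind]
  have : ∀ i, IsProbabilityMeasure (P.map (B i)) := fun i =>
    Measure.isProbabilityMeasure_map (hB i).aemeasurable
  rw [Measure.real, Measure.pi_singleton, ENNReal.toReal_prod]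
  refine Finset.prod_congr rfl fun i _ => ?_
  rw [Measure.map_apply (hB i) (measurableSet_singleton _)]
  cases b i
  · have h1 : B i ⁻¹' {false} = (B i ⁻¹' {true})ᶜ := by ext ω; simp
    have h2 := probReal_compl_eq_one_sub (μ := P) (hB i (measurableSet_singleton true))
    rw [h1]
    rw [hp i] at h2
    simpa [Measure.real] using h2
  · simpa [Measure.real] using hp i

/-! ### Discretising the Poisson process -/

/-- The `j`-th slot of length `1 / u`. -/
def slot (u : ℝ) (j : ℕ) : Set ℝ := Set.Ico (j / u) ((j + 1) / u)

theorem mem_slot {u : ℝ} (hu : 0 < u) {j : ℕ} {x : ℝ} : x ∈ slot u j ↔ 0 ≤ x ∧ ⌊x * u⌋₊ = j := by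
  rw [slot, Set.mem_Ico, div_le_iff₀ hu, lt_div_iff₀ hu]
  constructor
  · intro h
    have hx : 0 ≤ x * u := (Nat.cast_nonneg j).trans h.1
    exact ⟨nonneg_of_mul_nonneg_left hx hu, (Nat.floor_eq_iff hx).2 h⟩
  · rintro ⟨hx, h⟩
    exact (Nat.floor_eq_iff (mul_nonneg hx hu.le)).1 h

theorem isBounded_slot (u : ℝ) (j : ℕ) : Bornology.IsBounded (slot u j) := Metric.isBounded_Ico _ _

/-- Whether there is a point of `X` in the `j`-th slot. -/
noncomputable def slotBit {Ω : Type*} (X : Ω → Set ℝ) (u : ℝ) (j : ℕ) (ω : Ω) : Bool :=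
  decide (0 < (X ω ∩ slot u j).ncard)

/-- The number of admissions in slotted time with `n` slots covering `[0, t)`. -/
noncomputable def slottedCount {Ω : Type*} (k : ℕ) (X : Ω → Set ℝ) (t : ℝ) (n : ℕ) (ω : Ω) : ℕ :=
  slotAdmissions k ⌈(n : ℝ) / t⌉₊ [] (List.ofFn fun j : Fin n => slotBit X (n / t) j ω)

section

variable {Ω : Type*} [MeasurableSpace Ω] {P : Measure Ω} {lam : ℝ} {X : Ω → Set ℝ}

namespace IsPoissonProcess

theorem coe_arrivals (hX : IsPoissonProcess P lam X) (t : ℝ) (ω : Ω) :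
    (arrivals X t ω : Set ℝ) = Set.Icc 0 t ∩ X ω := by
  have h : (Set.Icc 0 t ∩ X ω).Finite := by
    rw [Set.inter_comm]
    exact hX.locallyFinite ω _ (Metric.isBounded_Icc _ _)
  rw [arrivals, dif_pos h, Set.Finite.coe_toFinset]

theorem mem_arrivals (hX : IsPoissonProcess P lam X) {t : ℝ} {ω : Ω} {x : ℝ} :
    x ∈ arrivals X t ω ↔ (0 ≤ x ∧ x ≤ t) ∧ x ∈ X ω := by
  rw [← Finset.mem_coe, hX.coe_arrivals]
  rfl

theorem colouredCount_eq_admittedCount (hX : IsPoissonProcess P lam X) (k : ℕ) (t : ℝ) (ω : Ω) :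
    colouredCount k X t ω = admittedCount k X t ω := by
  rw [colouredCount, admittedCount, ← hX.coe_arrivals, colourNumber_eq_card_erlangAdmitted]

theorem slotBit_eq_true (hX : IsPoissonProcess P lam X) {u : ℝ} (hu : 0 < u) {j : ℕ} {ω : Ω} :
    slotBit X u j ω = true ↔ ∃ x ∈ X ω, 0 ≤ x ∧ ⌊x * u⌋₊ = j := by
  rw [slotBit, decide_eq_true_iff, Set.ncard_pos (hX.locallyFinite ω _ (isBounded_slot u j))]
  simp only [Set.Nonempty, Set.mem_inter_iff, mem_slot hu]

/-- The `n` half-open slots cover `[0, t)` only; a point at `t` itself would fall into slot `n`, and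
this has probability zero. -/
theorem floor_lt (hX : IsPoissonProcess P lam X) {t : ℝ} (ht : 0 < t) {n : ℕ} {ω : Ω} (hn : 0 < n)
    (hω : t ∉ X ω) {x : ℝ} (hx : x ∈ arrivals X t ω) : ⌊x * (n / t)⌋₊ < n := by
  rw [hX.mem_arrivals] at hx
  have hxt : x < t := lt_of_le_of_ne hx.1.2 fun h => hω (h ▸ hx.2)
  have hn' : (0 : ℝ) < n := Nat.cast_pos.2 hn
  rw [Nat.floor_lt (mul_nonneg hx.1.1 (by positivity)), ← mul_div_assoc, div_lt_iff₀ ht, mul_comm]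
  exact mul_lt_mul_of_pos_left hxt hn'

theorem exists_of_floor_lt (hX : IsPoissonProcess P lam X) {t : ℝ} (ht : 0 < t) {n j : ℕ} {ω : Ω}
    (hj : j < n) : slotBit X (n / t) j ω = true →
      ∃ x ∈ arrivals X t ω, ⌊x * (n / t)⌋₊ = j := by
  have hn' : (0 : ℝ) < n := Nat.cast_pos.2 (by omega)
  rw [hX.slotBit_eq_true (by positivity)]
  rintro ⟨x, hxX, hx0, hxj⟩
  refine ⟨x, hX.mem_arrivals.2 ⟨⟨hx0, ?_⟩, hxX⟩, hxj⟩
  have h1 := Nat.lt_floor_add_one (x * (n / t))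
  rw [hxj, ← mul_div_assoc, div_lt_iff₀ ht] at h1
  have h2 : (j : ℝ) + 1 ≤ n := by exact_mod_cast hj
  have h3 : x * n < t * n := by nlinarith
  exact (lt_of_mul_lt_mul_right h3 hn'.le).le

/-- Provides the integrable bound, independent of `n`, for dominated convergence. -/
theorem slottedCount_le (hX : IsPoissonProcess P lam X) (k : ℕ) {t : ℝ} (ht : 0 < t) (n : ℕ)
    (ω : Ω) : slottedCount k X t n ω ≤ (X ω ∩ Set.Icc 0 t).ncard := by
  have h1 : (X ω ∩ Set.Icc 0 t).ncard = (arrivals X t ω).card := by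
    rw [Set.inter_comm, ← hX.coe_arrivals, Set.ncard_coe_finset]
  rw [h1]
  refine (slotAdmissions_le_count _ _ _ _).trans ?_
  have h2 : (List.ofFn fun j : Fin n => slotBit X (n / t) j ω).count true
      = (Finset.univ.filter fun j : Fin n => slotBit X (n / t) j ω = true).card := by
    rw [List.ofFn_eq_map, List.count_eq_countP, List.countP_map, List.countP_eq_length_filter,
      Finset.card_def, Finset.filter_val, Fin.univ_def]
    simp [Function.comp_def]
  rw [h2]
  calc _ = ((Finset.univ.filter fun j : Fin n => slotBit X (n / t) j ω = true).image
        fun j : Fin n => (j : ℕ)).card := (Finset.card_image_of_injective _ Fin.val_injective).symm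
    _ ≤ ((arrivals X t ω).image fun x => ⌊x * (n / t)⌋₊).card := by
        refine Finset.card_le_card fun j hj => ?_
        obtain ⟨i, hi, rfl⟩ := Finset.mem_image.1 hj
        exact Finset.mem_image.2 (hX.exists_of_floor_lt ht i.2 (Finset.mem_filter.1 hi).2)
    _ ≤ _ := Finset.card_image_le

theorem eventually_slottedCount_eq (hX : IsPoissonProcess P lam X) (k : ℕ) {t : ℝ} (ht : 0 < t)
    {ω : Ω} (hω : t ∉ X ω) : ∀ᶠ n : ℕ in atTop, slottedCount k X t n ω = colouredCount k X t ω := by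
  have h1 := (tendsto_natCast_atTop_atTop.atTop_div_const ht).eventually
    (eventually_floor_slots (arrivals X t ω) fun x hx => (hX.mem_arrivals.1 hx).1.1)
  filter_upwards [h1, eventually_gt_atTop 0] with n hn hn0
  rw [hX.colouredCount_eq_admittedCount, admittedCount,
    (isGreedySelection_erlangAdmitted k 1 (arrivals X t ω)).card_eq_slotAdmissions
      (fun x => ⌊x * (n / t)⌋₊) (fun x hx y hy h => (hn x hx y hy h).1)
      (fun x hx y hy h => (hn x hx y hy h).2) fun x hx => hX.floor_lt ht hn0 hω hx, slottedCount]
  congr 2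
  ext j
  rw [Bool.eq_iff_iff, decide_eq_true_iff]
  have hn' : (0 : ℝ) < n := Nat.cast_pos.2 hn0
  refine ⟨hX.exists_of_floor_lt ht j.2, ?_⟩
  rintro ⟨x, hx, hxj⟩
  rw [hX.mem_arrivals] at hx
  exact (hX.slotBit_eq_true (by positivity)).2 ⟨x, hx.2, hx.1.1, hxj⟩

theorem measurable_slotBit (hX : IsPoissonProcess P lam X) (u : ℝ) (j : ℕ) :
    Measurable (slotBit X u j) :=
  (Measurable.of_discrete (f := fun m : ℕ => decide (0 < m))).comp
    (hX.measurable_count _ measurableSet_Ico (isBounded_slot u j))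

theorem measurable_slottedCount (hX : IsPoissonProcess P lam X) (k : ℕ) (t : ℝ) (n : ℕ) :
    Measurable (slottedCount k X t n) :=
  (Measurable.of_discrete (f := fun b : Fin n → Bool =>
    slotAdmissions k ⌈(n : ℝ) / t⌉₊ [] (List.ofFn b))).comp
    (measurable_pi_lambda _ fun j : Fin n => hX.measurable_slotBit (n / t) j)

theorem measurable_slottedCount_real (hX : IsPoissonProcess P lam X) (k : ℕ) (t : ℝ) (n : ℕ) :
    Measurable fun ω => (slottedCount k X t n ω : ℝ) :=
  (Measurable.of_discrete (f := fun m : ℕ => (m : ℝ))).comp (hX.measurable_slottedCount k t n)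

theorem pairwise_disjoint_slot {u : ℝ} (hu : 0 < u) {n : ℕ} :
    Pairwise fun i j : Fin n => Disjoint (slot u i) (slot u j) := by
  intro i j hij
  rw [Set.disjoint_left]
  intro x hi hj
  rw [mem_slot hu] at hi hj
  exact hij (Fin.ext (hi.2.symm.trans hj.2))

theorem iIndepFun_slotBit (hX : IsPoissonProcess P lam X) {u : ℝ} (hu : 0 < u) (n : ℕ) :
    iIndepFun (fun j : Fin n => slotBit X u j) P :=
  (hX.indep n (fun j => slot u j) (fun j => ⟨measurableSet_Ico, isBounded_slot u j⟩)
    (pairwise_disjoint_slot hu)).comp (fun _ m => decide (0 < m)) fun _ => Measurable.of_discrete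

theorem measure_ncard_eq_zero (hX : IsPoissonProcess P lam X) {B : Set ℝ} (hB : MeasurableSet B)
    (hB' : Bornology.IsBounded B) (hlam : 0 ≤ lam) :
    P {ω | (X ω ∩ B).ncard = 0} = ENNReal.ofReal (Real.exp (-(lam * volume.real B))) := by
  rw [(hX.count_law B hB hB').measure_eq (p := fun m => m = 0) .of_discrete]
  have : {m : ℕ | m = 0} = {0} := rfl
  rw [this, poissonMeasure_singleton, Real.coe_toNNReal _ (mul_nonneg hlam measureReal_nonneg)]
  simp

theorem ae_disjoint_of_volume_eq_zero [IsProbabilityMeasure P] (hX : IsPoissonProcess P lam X)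
    (hlam : 0 ≤ lam) {B : Set ℝ} (hB : MeasurableSet B) (hB' : Bornology.IsBounded B)
    (h0 : volume.real B = 0) : ∀ᵐ ω ∂P, X ω ∩ B = ∅ := by
  have h1 : ∀ᵐ ω ∂P, (X ω ∩ B).ncard = 0 := by
    have hm : MeasurableSet {ω | (X ω ∩ B).ncard = 0} :=
      hX.measurable_count B hB hB' (measurableSet_singleton 0)
    rw [ae_iff, ← Set.compl_ofPred, prob_compl_eq_zero_iff hm,
      hX.measure_ncard_eq_zero hB hB' hlam, h0]
    simp
  filter_upwards [h1] with ω hω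
  exact (Set.ncard_eq_zero (hX.locallyFinite ω B hB')).1 hω

theorem measureReal_slotBit [IsProbabilityMeasure P] (hX : IsPoissonProcess P lam X)
    (hlam : 0 ≤ lam) {u : ℝ} (hu : 0 < u) (j : ℕ) :
    P.real (slotBit X u j ⁻¹' {true}) = 1 - Real.exp (-(lam / u)) := by
  have hc : slotBit X u j ⁻¹' {true} = {ω | (X ω ∩ slot u j).ncard = 0}ᶜ := by
    ext ω
    simp [slotBit, Nat.pos_iff_ne_zero]
  have hm : MeasurableSet {ω | (X ω ∩ slot u j).ncard = 0} :=
    hX.measurable_count _ measurableSet_Ico (isBounded_slot u j) (measurableSet_singleton 0)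
  rw [hc, probReal_compl_eq_one_sub hm, Measure.real,
    hX.measure_ncard_eq_zero (B := slot u j) measurableSet_Ico (isBounded_slot u j) hlam,
    ENNReal.toReal_ofReal (Real.exp_nonneg _)]
  have : volume.real (slot u j) = 1 / u := by
    rw [slot, Real.volume_real_Ico_of_le (by gcongr; linarith)]
    ring
  rw [this, mul_one_div]

theorem integral_slotted [IsProbabilityMeasure P] (hX : IsPoissonProcess P lam X)
    (hlam : 0 ≤ lam) (k : ℕ) {t : ℝ} (ht : 0 < t) {n : ℕ} (hn : 0 < n) (f : ℕ → ℝ) :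
    ∫ ω, f (slottedCount k X t n ω) ∂P = bitE (1 - Real.exp (-(lam * t / n))) n
      fun b => f (slotAdmissions k ⌈(n : ℝ) / t⌉₊ [] b) := by
  have hu : (0 : ℝ) < n / t := div_pos (Nat.cast_pos.2 hn) ht
  have hp : lam * t / n = lam / (n / t) := by field_simp
  rw [hp]
  exact integral_ofFn_eq_bitE (fun i => hX.measurable_slotBit _ _) (hX.iIndepFun_slotBit hu n)
    (fun i => hX.measureReal_slotBit hlam hu i)
    fun b => f (slotAdmissions k ⌈(n : ℝ) / t⌉₊ [] b)

theorem bounds_slotted [IsProbabilityMeasure P] (hX : IsPoissonProcess P lam X)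
    (hlam : 0 < lam) (k : ℕ) {t : ℝ} (ht : 0 < t) {n : ℕ} (hn : 0 < n) :
    let ρ := slotRate k ⌈(n : ℝ) / t⌉₊ (Real.exp (lam * t / n) - 1)
    n * ρ ≤ ∫ ω, (slottedCount k X t n ω : ℝ) ∂P ∧
      ∫ ω, (slottedCount k X t n ω : ℝ) ∂P ≤ n * ρ + k ∧
      ∫ ω, ((slottedCount k X t n ω : ℝ) - n * ρ) ^ 2 ∂P ≤ lam * t * (4 * k + 2) := by
  intro ρ
  have hn' : (0 : ℝ) < n := Nat.cast_pos.2 hn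
  have hc : 0 ≤ lam * t / n := by positivity
  have hp0 : 0 ≤ 1 - Real.exp (-(lam * t / n)) :=
    sub_nonneg.2 (Real.exp_le_one_iff.2 (neg_nonpos.2 hc))
  have hp1 : 1 - Real.exp (-(lam * t / n)) ≤ 1 := by linarith [Real.exp_nonneg (-(lam * t / n))]
  have hr0 : 0 ≤ Real.exp (lam * t / n) - 1 := sub_nonneg.2 (Real.one_le_exp hc)
  -- The odds `p / (1 - p)` of `p = 1 - exp (-c)` are `exp c - 1`.
  have hr : (Real.exp (lam * t / n) - 1) * (1 - (1 - Real.exp (-(lam * t / n))))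
      = 1 - Real.exp (-(lam * t / n)) := by
    have : Real.exp (lam * t / n) * Real.exp (-(lam * t / n)) = 1 := by
      rw [← Real.exp_add, add_neg_cancel, Real.exp_zero]
    linear_combination this
  rw [hX.integral_slotted hlam.le k ht hn fun m => (m : ℝ),
    hX.integral_slotted hlam.le k ht hn fun m => ((m : ℝ) - n * ρ) ^ 2]
  refine ⟨mul_slotRate_le_mean_nil k _ hp0 hp1 hr0 hr n, mean_nil_le k _ hp0 hp1 hr0 hr n,
    (secondMoment_le k _ hp0 hp1 hr0 hr n [] (by simp)).trans ?_⟩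
  -- Since `p ≤ λt / n`, the second moment bound `n * p * (4 * k + 2)` no longer depends on `n`.
  have h1 : 1 - Real.exp (-(lam * t / n)) ≤ lam * t / n := by
    linarith [Real.add_one_le_exp (-(lam * t / n))]
  calc (n : ℝ) * ((1 - Real.exp (-(lam * t / n))) * (4 * k + 2))
      ≤ n * (lam * t / n * (4 * k + 2)) := by gcongr
    _ = lam * t * (4 * k + 2) := by field_simp

theorem integrable_ncard (hX : IsPoissonProcess P lam X) {B : Set ℝ} (hB : MeasurableSet B)
    (hB' : Bornology.IsBounded B) : Integrable (fun ω => ((X ω ∩ B).ncard : ℝ)) P := by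
  have hlaw := hX.count_law B hB hB'
  have h : Integrable (fun m : ℕ => (m : ℝ)) (P.map fun ω => (X ω ∩ B).ncard) := by
    rw [hlaw.map_eq, integrable_poissonMeasure_iff, ← summable_nat_add_iff 1]
    set r := (Real.toNNReal (lam * volume.real B))
    -- After the index shift, `(n + 1) / (n + 1)! = 1 / n!`, so the series is `r` times the total
    -- Poisson mass.
    refine ((hasSum_one_poissonMeasure r).summable.mul_left (r : ℝ)).congr fun n => ?_
    rw [Nat.factorial_succ, Real.norm_natCast]
    push_cast
    field_simp
    ring
  exact h.comp_aemeasurable hlaw.aemeasurable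

/-! ### Passage to the limit in the number of slots, then in time -/

variable [IsProbabilityMeasure P]

theorem ae_notMem (hX : IsPoissonProcess P lam X) (hlam : 0 ≤ lam) (t : ℝ) :
    ∀ᵐ ω ∂P, t ∉ X ω := by
  filter_upwards [hX.ae_disjoint_of_volume_eq_zero hlam (measurableSet_singleton t)
    Bornology.isBounded_singleton
    (by rw [Measure.real, Real.volume_singleton, ENNReal.toReal_zero])] with ω hω h
  exact (Set.eq_empty_iff_forall_notMem.1 hω t) ⟨h, rfl⟩

theorem ae_tendsto_slottedCount (hX : IsPoissonProcess P lam X) (hlam : 0 ≤ lam) (k : ℕ) {t : ℝ}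
    (ht : 0 < t) : ∀ᵐ ω ∂P, Tendsto (fun n : ℕ => (slottedCount k X t n ω : ℝ)) atTop
      (𝓝 (colouredCount k X t ω : ℝ)) := by
  filter_upwards [hX.ae_notMem hlam t] with ω hω
  refine tendsto_const_nhds.congr' ?_
  filter_upwards [hX.eventually_slottedCount_eq k ht hω] with n hn
  rw [hn]

theorem tendsto_integral_slottedCount (hX : IsPoissonProcess P lam X) (hlam : 0 ≤ lam) (k : ℕ)
    {t : ℝ} (ht : 0 < t) : Tendsto (fun n : ℕ => ∫ ω, (slottedCount k X t n ω : ℝ) ∂P) atTop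
      (𝓝 (∫ ω, (colouredCount k X t ω : ℝ) ∂P)) := by
  refine tendsto_integral_of_dominated_convergence (fun ω => ((X ω ∩ Set.Icc 0 t).ncard : ℝ))
    (fun n => (hX.measurable_slottedCount_real k t n).aestronglyMeasurable)
    (hX.integrable_ncard measurableSet_Icc (Metric.isBounded_Icc _ _))
    (fun n => Eventually.of_forall fun ω => ?_) (hX.ae_tendsto_slottedCount hlam k ht)
  rw [Real.norm_natCast]
  exact_mod_cast hX.slottedCount_le k ht n ω

/-- For `t > 0`, measurability up to null sets comes from the almost sure limit of the slotted
counts. For `t ≤ 0` the interval is a null set, so the count is almost surely constant. -/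
theorem integrable_colouredCount (hX : IsPoissonProcess P lam X) (hlam : 0 ≤ lam) (k : ℕ)
    (t : ℝ) : Integrable (fun ω => (colouredCount k X t ω : ℝ)) P := by
  rcases le_or_gt t 0 with ht | ht
  · have : (fun ω => (colouredCount k X t ω : ℝ)) =ᵐ[P]
        fun _ => (colourNumber k 1 (∅ : Set ℝ) : ℝ) := by
      have h0 : volume.real (Set.Icc 0 t) = 0 := by
        rw [Real.volume_real_Icc, sub_zero, max_eq_right ht]
      filter_upwards [hX.ae_disjoint_of_volume_eq_zero hlam measurableSet_Icc
        (Metric.isBounded_Icc 0 t) h0] with ω hω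
      rw [colouredCount, Set.inter_comm, hω]
    exact (integrable_const _).congr this.symm
  · have hlim := hX.ae_tendsto_slottedCount hlam k ht
    refine (hX.integrable_ncard measurableSet_Icc (Metric.isBounded_Icc 0 t)).mono'
      (aemeasurable_of_tendsto_metrizable_ae' (fun n =>
        (hX.measurable_slottedCount_real k t n).aemeasurable) hlim).aestronglyMeasurable ?_
    filter_upwards [hlim] with ω hω
    rw [Real.norm_natCast]
    exact le_of_tendsto' hω fun n => by exact_mod_cast hX.slottedCount_le k ht n ω

theorem integral_colouredCount_bounds (hX : IsPoissonProcess P lam X) (hlam : 0 < lam) (k : ℕ)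
    {t : ℝ} (ht : 0 < t) :
    lam * t * (1 - erlangLoss lam k) ≤ ∫ ω, (colouredCount k X t ω : ℝ) ∂P ∧
      ∫ ω, (colouredCount k X t ω : ℝ) ∂P ≤ lam * t * (1 - erlangLoss lam k) + k := by
  have h1 := hX.tendsto_integral_slottedCount hlam.le k ht
  have h2 := tendsto_mul_slotRate hlam ht k
  constructor
  · refine le_of_tendsto_of_tendsto h2 h1 ?_
    filter_upwards [eventually_gt_atTop 0] with n hn
    exact (hX.bounds_slotted hlam k ht hn).1
  · refine le_of_tendsto_of_tendsto h1 (h2.add_const (k : ℝ)) ?_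
    filter_upwards [eventually_gt_atTop 0] with n hn
    exact (hX.bounds_slotted hlam k ht hn).2.1

/-- Fatou's lemma along the slotted counts; only an upper bound is needed, so no domination of the
squares is required. -/
theorem lintegral_sq_le (hX : IsPoissonProcess P lam X) (hlam : 0 < lam) (k : ℕ)
    {t : ℝ} (ht : 0 < t) :
    ∫⁻ ω, ENNReal.ofReal (((colouredCount k X t ω : ℝ) - lam * t * (1 - erlangLoss lam k)) ^ 2) ∂P
      ≤ ENNReal.ofReal (lam * t * (4 * k + 2)) := by
  set c : ℕ → ℝ := fun n => n * slotRate k ⌈(n : ℝ) / t⌉₊ (Real.exp (lam * t / n) - 1)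
  set G : ℕ → Ω → ENNReal := fun n ω => ENNReal.ofReal (((slottedCount k X t n ω : ℝ) - c n) ^ 2)
  have hmeas : ∀ n, Measurable fun ω => ((slottedCount k X t n ω : ℝ) - c n) ^ 2 := fun n =>
    ((hX.measurable_slottedCount_real k t n).sub_const _).pow_const 2
  have hlim : ∀ᵐ ω ∂P, ENNReal.ofReal
      (((colouredCount k X t ω : ℝ) - lam * t * (1 - erlangLoss lam k)) ^ 2)
      = liminf (fun n => G n ω) atTop := by
    filter_upwards [hX.ae_tendsto_slottedCount hlam.le k ht] with ω hω
    exact (ENNReal.tendsto_ofReal ((hω.sub (tendsto_mul_slotRate hlam ht k)).pow 2)).liminf_eq.symm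
  rw [lintegral_congr_ae hlim]
  refine (lintegral_liminf_le fun n => (hmeas n).ennreal_ofReal).trans ?_
  refine liminf_le_of_frequently_le' (Eventually.frequently ?_)
  filter_upwards [eventually_gt_atTop 0] with n hn
  -- At most one admission per slot, so for fixed `n` the slotted count is bounded by `n`.
  have hint : Integrable (fun ω => ((slottedCount k X t n ω : ℝ) - c n) ^ 2) P := by
    refine Integrable.of_bound (hmeas n).aestronglyMeasurable (((n : ℝ) + |c n|) ^ 2)
      (Eventually.of_forall fun ω => ?_)
    have h1 : slottedCount k X t n ω ≤ n := by
      refine (slotAdmissions_le_count _ _ _ _).trans (List.count_le_length.trans_eq ?_)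
      rw [List.length_ofFn]
    have h2 : (slottedCount k X t n ω : ℝ) ≤ n := by exact_mod_cast h1
    rw [Real.norm_eq_abs, abs_pow]
    gcongr
    refine (abs_sub _ _).trans ?_
    rw [Nat.abs_cast]
    gcongr
  rw [← ofReal_integral_eq_lintegral_ofReal hint (Eventually.of_forall fun ω => sq_nonneg _)]
  exact ENNReal.ofReal_le_ofReal (hX.bounds_slotted hlam k ht hn).2.2

/-- Chebyshev's inequality: the second moment is of order `t` and the squared threshold `(ε * (lam *
t)) ^ 2` of order `t ^ 2`. -/
theorem tendstoInMeasure_admittedCount (hX : IsPoissonProcess P lam X) (hlam : 0 < lam) (k : ℕ) :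
    TendstoInMeasure P (fun (t : ℝ) ω => (admittedCount k X t ω : ℝ) / (lam * t)) atTop
      (fun _ => 1 - erlangLoss lam k) := by
  rw [tendstoInMeasure_iff_dist]
  intro ε hε
  set a := 1 - erlangLoss lam k
  have hb : Tendsto (fun t : ℝ => ENNReal.ofReal ((4 * k + 2) / (ε ^ 2 * lam) / t)) atTop
      (𝓝 0) := by
    rw [← ENNReal.ofReal_zero]
    exact ENNReal.tendsto_ofReal (tendsto_id.const_div_atTop _)
  refine tendsto_of_tendsto_of_tendsto_of_le_of_le' tendsto_const_nhds hb
    (Eventually.of_forall fun _ => zero_le) ?_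
  filter_upwards [eventually_gt_atTop 0] with t ht
  have hlt : 0 < lam * t := by positivity
  have hsub : {ω | ε ≤ dist ((admittedCount k X t ω : ℝ) / (lam * t)) a} ⊆
      {ω | ENNReal.ofReal ((ε * (lam * t)) ^ 2)
        ≤ ENNReal.ofReal (((colouredCount k X t ω : ℝ) - lam * t * a) ^ 2)} := by
    intro ω hω
    refine ENNReal.ofReal_le_ofReal ?_
    rw [← sq_abs ((colouredCount k X t ω : ℝ) - lam * t * a)]
    refine pow_le_pow_left₀ (by positivity) ?_ 2
    have h1 : (colouredCount k X t ω : ℝ) - lam * t * a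
        = ((admittedCount k X t ω : ℝ) / (lam * t) - a) * (lam * t) := by
      rw [hX.colouredCount_eq_admittedCount]
      field_simp
    rw [h1, abs_mul, abs_of_pos hlt]
    exact mul_le_mul_of_nonneg_right hω hlt.le
  have hG : AEMeasurable (fun ω => ENNReal.ofReal
      (((colouredCount k X t ω : ℝ) - lam * t * a) ^ 2)) P :=
    (((hX.integrable_colouredCount hlam.le k t).aemeasurable.sub_const _).pow_const
      2).ennreal_ofReal
  have hpos : 0 < (ε * (lam * t)) ^ 2 := by positivity
  calc _ ≤ _ := measure_mono hsub
    _ ≤ _ := meas_ge_le_lintegral_div hG (ENNReal.ofReal_pos.2 hpos).ne' ENNReal.ofReal_ne_top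
    _ ≤ ENNReal.ofReal (lam * t * (4 * k + 2)) / ENNReal.ofReal ((ε * (lam * t)) ^ 2) :=
        ENNReal.div_le_div_right (hX.lintegral_sq_le hlam k ht) _
    _ = _ := by
        rw [← ENNReal.ofReal_div_of_pos hpos]
        congr 1
        field_simp

theorem meanColouringRatio_bounds (hX : IsPoissonProcess P lam X) (hlam : 0 < lam) (k : ℕ)
    {t : ℝ} (ht : 0 < t) :
    1 - erlangLoss lam k ≤ meanColouringRatio P lam X k t ∧
      meanColouringRatio P lam X k t ≤ 1 - erlangLoss lam k + k / lam / t := by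
  have hlt : 0 < lam * t := by positivity
  obtain ⟨h1, h2⟩ := hX.integral_colouredCount_bounds hlam k ht
  rw [meanColouringRatio, integral_div, le_div_iff₀ hlt, div_le_iff₀ hlt]
  refine ⟨by linarith, h2.trans_eq ?_⟩
  field_simp

theorem tendsto_meanColouringRatio (hX : IsPoissonProcess P lam X) (hlam : 0 < lam) (k : ℕ) :
    Tendsto (fun t : ℝ => meanColouringRatio P lam X k t) atTop (𝓝 (1 - erlangLoss lam k)) := by
  have hb : Tendsto (fun t : ℝ => 1 - erlangLoss lam k + k / lam / t) atTop
      (𝓝 (1 - erlangLoss lam k)) := by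
    simpa using (tendsto_id.const_div_atTop (k / lam : ℝ)).const_add (1 - erlangLoss lam k)
  refine tendsto_of_tendsto_of_tendsto_of_le_of_le' tendsto_const_nhds hb ?_ ?_
  · filter_upwards [eventually_gt_atTop 0] with t ht
    exact (hX.meanColouringRatio_bounds hlam k ht).1
  · filter_upwards [eventually_gt_atTop 0] with t ht
    exact (hX.meanColouringRatio_bounds hlam k ht).2

/-- The limit is also a lower bound of the ratio at every `t > 0`, hence equals the infimum; no
subadditivity argument is needed. -/
theorem colouringConstant_eq (hX : IsPoissonProcess P lam X) (hlam : 0 < lam) (k : ℕ) :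
    colouringConstant P lam X k = 1 - erlangLoss lam k := by
  have hbdd : BddBelow (Set.range fun t : Set.Ioi (0 : ℝ) => meanColouringRatio P lam X k t) :=
    ⟨1 - erlangLoss lam k, by
      rintro _ ⟨t, rfl⟩
      exact (hX.meanColouringRatio_bounds hlam k t.2).1⟩
  have : Nonempty (Set.Ioi (0 : ℝ)) := ⟨⟨1, Set.mem_Ioi.2 one_pos⟩⟩
  refine le_antisymm ?_ (le_ciInf fun t => (hX.meanColouringRatio_bounds hlam k t.2).1)
  refine ge_of_tendsto (hX.tendsto_meanColouringRatio hlam k) ?_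
  filter_upwards [eventually_gt_atTop 0] with t ht
  exact ciInf_le hbdd ⟨t, ht⟩

end IsPoissonProcess

end

end RGGColouring

theorem mainTheorem6 (k : ℕ) :
    -- a greedy run exists for every finite set of points, and the result of every greedy run is a
    -- maximum proper `k`-colouring whose coloured points are the customers that are admitted in
    -- the Erlang loss system
    (∀ V : Finset ℝ,
      (∃ c, RGGColouring.GreedyRun k V c) ∧
      ∀ c, RGGColouring.GreedyRun k V c →
        RGGColouring.IsProperOn 1 V c ∧
        (RGGColouring.colouredPart V c).card = RGGColouring.colourNumber k 1 (V : Set ℝ) ∧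
        RGGColouring.colouredPart V c = RGGColouring.erlangAdmitted k 1 V) ∧
    ∀ (lam : ℝ), 0 < lam →
      ∀ {Ω : Type*} [MeasurableSpace Ω] (P : Measure Ω) [IsProbabilityMeasure P]
        (X : Ω → Set ℝ), RGGColouring.IsPoissonProcess P lam X →
        (∀ t ω, RGGColouring.colouredCount k X t ω = RGGColouring.admittedCount k X t ω) ∧
        (∀ t, Integrable (fun ω => (RGGColouring.colouredCount k X t ω : ℝ)) P) ∧
        TendstoInMeasure P
          (fun (t : ℝ) ω => (RGGColouring.admittedCount k X t ω : ℝ) / (lam * t)) atTop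
          (fun _ => 1 - RGGColouring.erlangLoss lam k) ∧
        Tendsto (fun t : ℝ => RGGColouring.meanColouringRatio P lam X k t) atTop
          (𝓝 (RGGColouring.colouringConstant P lam X k)) ∧
        RGGColouring.colouringConstant P lam X k = 1 - RGGColouring.erlangLoss lam k ∧
        RGGColouring.colouringConstant P lam X k =
          (∑ m ∈ Finset.range k, lam ^ m / (m.factorial : ℝ)) /
            ∑ l ∈ Finset.range (k + 1), lam ^ l / (l.factorial : ℝ) := by
  refine ⟨fun V => ⟨RGGColouring.exists_greedyRun k V, fun c h =>
    ⟨h.isProperOn, h.card_colouredPart, h.colouredPart_eq⟩⟩, ?_⟩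
  intro lam hlam Ω _ P _ X hX
  have ha := hX.colouringConstant_eq hlam k
  refine ⟨fun t ω => hX.colouredCount_eq_admittedCount k t ω,
    fun t => hX.integrable_colouredCount hlam.le k t, hX.tendstoInMeasure_admittedCount hlam k,
    ?_, ha, ?_⟩
  · rw [ha]
    exact hX.tendsto_meanColouringRatio hlam k
  · rw [ha, RGGColouring.one_sub_erlangLoss hlam]
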